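/- Let $\mathcal X,\mathcal Y,\mathcal Z$ be finite alphabets, let $W(y|x)$ be a discrete memoryless channel from $\mathcal X$ to $\mathcal Y$, and let $q:\mathcal X\times\mathcal Y\to\mathbb R\cup\{-\infty\}$ be a single-letter metric. Logarithms are natural, and $0\cdot(-\infty)=0$. *Mismatch capacity.* For a codebook $\mathcal C_n=(\boldsymbol x_1,\dots,\boldsymbol x_{M_n})$ of words in $\mathcal X^n$, a uniformly distributed message $m$ is sent as $\boldsymbol x_m$ over $W^n(\boldsymbol y|\boldsymbol x)=\prod_{k=1}^nW(y_k|x_k)$, and the decoder outputs $\widehat m\in\arg\max_i q(\boldsymbol x_i,\boldsymbol y)$, where $q(\boldsymbol x,\boldsymbol y)=\frac1n\sum_{k=1}^n q(x_k,y_k)$, ties being broken uniformly at random among the maximizers. Let $P_e(W,\mathcal C_n,q)=\Pr[\widehat m\ne m]$. A rate $R$ is achievable if there are codebooks $\mathcal C_n$, $n=1,2,\dots$, with $M_n\ge 1$, $\frac1n\log M_n\ge R$ for all $n$ and $\lim_{n\to\infty}P_e(W,\mathcal C_n,q)=0$. The mismatch capacity $C_q(W)$ is the supremum of the achievable rates.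 *The bound.* For a distribution $P_X$ on $\mathcal X$, let $\mathcal W_q(P_X)$ be the set of two-output channels $P_{YZ|X}$ from $\mathcal X$ to $\mathcal Y\times\mathcal Z$ such that, with $P_{XYZ}=P_X\times P_{YZ|X}$, $$\mathbb E_V\, q(\widetilde X,Y)\;\ge\;\mathbb E_{P}\, q(X,Y)$$ for every joint distribution $V_{U\widetilde XXZY}$, where $\widetilde X$ takes values in $\mathcal X$ and $U$ takes values in an alphabet of size at most $|\mathcal X|^2|\mathcal Z|$, that satisfies: $V_{XZY}=P_{XZY}$; $V_{U\widetilde XXZ}(u,x_1,x_2,z)=V_{U\widetilde XXZ}(u,x_2,x_1,z)$ for all $u,x_1,x_2,z$; and the Markov chains $\widetilde X-(U,Z)-X$ and $(\widetilde X,U)-(X,Z)-Y$. Put $$\overline C_q(W)=\sup_{P_X}\ \inf_{\substack{P_{YZ|X}\in\mathcal W_q(P_X)\\ P_{Y|X}=W}} I(X;Z),$$ where $I(X;Z)$ is computed under $P_X\times P_{Z|X}$ and the infimum over the empty set is $+\infty$. **Theorem.** For every such $W$, $q$ and $\mathcal Z$, $$C_q(W)\le\overline C_q(W).$$ -/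

import Mathlib

namespace MismatchDecoding

/-- `W x` is a probability mass function on `B` for every `x` (a stochastic kernel between finite
alphabets; a discrete memoryless channel is determined by its one-letter kernel). -/
def IsChannel {A B : Type*} [Fintype B] (W : A → B → ℝ) : Prop :=
  ∀ a, W a ∈ stdSimplex ℝ B

/-- Expectation of an extended-real function under a mass function `p` on a finite set. With the
convention `0 * ⊥ = 0`, it equals `⊥` as soon as `f = ⊥` at a point of positive mass
(for `f` without the value `⊤`). -/
noncomputable def expect {A : Type*} [Fintype A] (p : A → ℝ) (f : A → EReal) : EReal :=
  ∑ a, (p a : EReal) * f a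

/-! ### Mismatched decoding and the mismatch capacity -/

/-- The memoryless extension `Wⁿ(y | x) = ∏ₖ W(yₖ | xₖ)`. -/
noncomputable def blockChannel {X Y : Type*} (W : X → Y → ℝ) {n : ℕ}
    (x : Fin n → X) (y : Fin n → Y) : ℝ :=
  ∏ k, W (x k) (y k)

/-- The additive `n`-letter metric `q(x, y) = (1/n) ∑ᵢ q(xᵢ, yᵢ)`. -/
noncomputable def blockMetric {X Y : Type*} (q : X → Y → EReal) {n : ℕ}
    (x : Fin n → X) (y : Fin n → Y) : EReal :=
  ((1 / (n : ℝ) : ℝ) : EReal) * ∑ i, q (x i) (y i)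

open Classical in
/-- The messages whose codewords maximize the metric for the channel output `y`. -/
noncomputable def maximizers {X Y : Type*} (q : X → Y → EReal) {n M : ℕ}
    (c : Fin M → Fin n → X) (y : Fin n → Y) : Finset (Fin M) :=
  Finset.univ.filter fun m => ∀ j, blockMetric q (c j) y ≤ blockMetric q (c m) y

open Classical in
/-- The probability that the decoder outputs `m` on `y`: uniform among the maximizers. -/
noncomputable def decodeProb {X Y : Type*} (q : X → Y → EReal) {n M : ℕ}
    (c : Fin M → Fin n → X) (y : Fin n → Y) (m : Fin M) : ℝ :=
  if m ∈ maximizers q c y then 1 / ((maximizers q c y).card : ℝ) else 0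

/-- The average error probability, for equiprobable messages, of the codebook `c` over the channel
`W` when decoded with the metric `q`. -/
noncomputable def errorProb {X Y : Type*} [Fintype Y] (W : X → Y → ℝ) (q : X → Y → EReal)
    {n M : ℕ} (c : Fin M → Fin n → X) : ℝ :=
  (1 / (M : ℝ)) * ∑ m, ∑ y : Fin n → Y,
    blockChannel W (c m) y * ∑ m' ∈ Finset.univ.erase m, decodeProb q c y m'

/-- The rate `R` (in nats) is achievable over `W` with decoding metric `q`. -/
def IsAchievable {X Y : Type*} [Fintype Y] (W : X → Y → ℝ) (q : X → Y → EReal) (R : ℝ) : Prop :=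
  ∃ (M : ℕ → ℕ) (c : ∀ n, Fin (M n) → Fin n → X),
    (∀ n, 1 ≤ n → 1 ≤ M n ∧ R ≤ 1 / (n : ℝ) * Real.log (M n)) ∧
    Filter.Tendsto (fun n => errorProb W q (c n)) Filter.atTop (nhds 0)

/-- The mismatch capacity `C_q(W)`: the supremum of the achievable rates. -/
noncomputable def mismatchCapacity {X Y : Type*} [Fintype Y]
    (W : X → Y → ℝ) (q : X → Y → EReal) : EReal :=
  ⨆ (R : ℝ) (_ : IsAchievable W q R), (R : EReal)

/-! ### The single-letter bound -/

/-- Mutual information (in nats) of the joint mass function `p` on `A × B`. -/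
noncomputable def mutualInfo {A B : Type*} [Fintype A] [Fintype B] (p : A → B → ℝ) : ℝ :=
  ∑ a, ∑ b, p a b * Real.log (p a b / ((∑ b', p a b') * ∑ a', p a' b))

/-- The Markov chain `A - B - C` under the joint mass function `p`:
`p(a,b,c) p(b) = p(a,b) p(b,c)`. -/
def IsMarkov {A B C : Type*} [Fintype A] [Fintype C] (p : A → B → C → ℝ) : Prop :=
  ∀ a b c, p a b c * (∑ a', ∑ c', p a' b c') = (∑ c', p a b c') * (∑ a', p a' b c)

/-- The admissible joint laws `J` of `(U, X̃, X, Z, Y)`, for the input distribution `P` and the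
two-output channel `V = P_{YZ|X}`. -/
structure IsCoupling {U X Y Z : Type*} [Fintype U] [Fintype X] [Fintype Y] [Fintype Z]
    (P : X → ℝ) (V : X → Y × Z → ℝ) (J : U × X × X × Z × Y → ℝ) : Prop where
  /-- `J` is a probability mass function. -/
  mem_simplex : J ∈ stdSimplex ℝ (U × X × X × Z × Y)
  /-- The law of `(X, Z, Y)` is `P × V`. -/
  marginal : ∀ x z y, ∑ u, ∑ x', J (u, x', x, z, y) = P x * V x (y, z)
  /-- The law of `(U, X̃, X, Z)` is symmetric in `(X̃, X)`. -/
  symmetric : ∀ u x₁ x₂ z, ∑ y, J (u, x₁, x₂, z, y) = ∑ y, J (u, x₂, x₁, z, y)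
  /-- `X̃ - (U, Z) - X`. -/
  markov_input : IsMarkov fun (x' : X) (uz : U × Z) (x : X) => ∑ y, J (uz.1, x', x, uz.2, y)
  /-- `(X̃, U) - (X, Z) - Y`. -/
  markov_output : IsMarkov fun (xu : X × U) (xz : X × Z) (y : Y) => J (xu.2, xu.1, xz.1, xz.2, y)

/-- The set `𝒲_q(P)` of two-output channels `V = P_{YZ|X}` for which the minimum of `E q(X̃, Y)`
over the admissible joint laws, with an auxiliary alphabet of size at most `|X|² |Z|`,
is at least `E q(X, Y)`. -/
def channelSet {X Y Z : Type*} [Fintype X] [Fintype Y] [Fintype Z]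
    (q : X → Y → EReal) (P : X → ℝ) : Set (X → Y × Z → ℝ) :=
  {V | IsChannel V ∧
    expect (fun a : X × Y × Z => P a.1 * V a.1 a.2) (fun a => q a.1 a.2.1) ≤
      ⨅ (k : ℕ) (_ : k ≤ Fintype.card X ^ 2 * Fintype.card Z)
        (J : Fin k × X × X × Z × Y → ℝ) (_ : IsCoupling P V J),
        expect J (fun a => q a.2.1 a.2.2.2.2)}

/-- The bound: the supremum over input distributions `P` of the infimum of `I(X; Z)` over the
channels `P_{YZ|X}` in `𝒲_q(P)` with `P_{Y|X} = W`. The infimum over the empty set is `⊤`. -/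
noncomputable def capacityBound {X Y : Type*} (Z : Type*) [Fintype X] [Fintype Y] [Fintype Z]
    (W : X → Y → ℝ) (q : X → Y → EReal) : EReal :=
  ⨆ (P : X → ℝ) (_ : P ∈ stdSimplex ℝ X),
    ⨅ (V : X → Y × Z → ℝ) (_ : V ∈ channelSet q P) (_ : ∀ x y, ∑ z, V x (y, z) = W x y),
      ((mutualInfo fun x z => P x * ∑ y, V x (y, z) : ℝ) : EReal)

end MismatchDecoding

/-!
The argument compares the decoder with a second receiver that observes `Zⁿ`.

Testing the condition that defines `channelSet q P` on suitable couplings decouples it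
(`channelSet_pairwise`), unless the expected metric of the true input is `⊥`: for every output `z`
and every two inputs `x₁`, `x₂` of positive probability that can both produce `z`, exchanging the
roles of `x₁` and `x₂` does not decrease the metric on average, when `Y` has its law given the true
input and `z`. The coupling takes `X̃ = X` except on a small event at the output `z`, where `X̃` and `X` are independent and uniform on
`{x₁, x₂}`; the auxiliary variable `U` records which case holds.

The pairwise condition holds at each letter, so that it tensorizes (`exists_confusion_bound`): for
any two words `w`, `w'` with letters in the support of `P` and any `z` that both can produce, either
`w'` beats `w` with a probability bounded below when `w` is sent and `Zⁿ = z`, or the other way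
round. Nothing but the finiteness of the set of metric differences is used to bound the
probability; this is an anticoncentration bound for sums of independent variables of nonnegative
mean (`exists_le_prodExpect_sum_nonneg`), uniform in the block length, the words and the channel.

Now let a code have rate above the bound. The codewords that can have metric `⊥` at their own output
have errors bounded below, and hence are a minority. Let `P` be the average empirical distribution
of the other codewords, and choose `V` in `channelSet q P` with output law `W` and with `I(X; Z)`
below the rate. A message drawn from the posterior law given `Zⁿ` differs from the true one with
a probability bounded below, by Fano's inequality (`fano_le`). The true and the drawn message are
exchangeable, so the pairwise confusion turns this into a lower bound on the error of the decoder
(`card_sub_le_error`). This contradicts a vanishing error probability.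
-/

namespace MismatchDecoding

/-! ### Sums of independent variables on a finite set -/

/-- Expectation of `f` under the product `∏ₖ p k` of mass functions on a finite set. The `p k` are
not required to be normalized. -/
noncomputable def prodExpect {Ω : Type*} [Fintype Ω] {n : ℕ} (p : Fin n → Ω → ℝ)
    (f : (Fin n → Ω) → ℝ) : ℝ :=
  ∑ w : Fin n → Ω, (∏ k, p k (w k)) * f w

section prodExpect

variable {Ω : Type*} [Fintype Ω] {n : ℕ}

lemma prodExpect_succ (p : Fin (n + 1) → Ω → ℝ) (f : (Fin (n + 1) → Ω) → ℝ) :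
    prodExpect p f =
      ∑ a, p 0 a * prodExpect (fun k => p k.succ) (fun w => f (Fin.cons a w)) := by
  unfold prodExpect
  rw [← (Fin.consEquiv fun _ => Ω).sum_comp, Fintype.sum_prod_type]
  refine Finset.sum_congr rfl fun a _ => ?_
  rw [Finset.mul_sum]
  refine Finset.sum_congr rfl fun w _ => ?_
  rw [show Fin.consEquiv (fun _ => Ω) (a, w) = Fin.cons a w from rfl]
  simp [Fin.prod_univ_succ, mul_assoc]

lemma prodExpect_prod (p g : Fin n → Ω → ℝ) :
    prodExpect p (fun w => ∏ k, g k (w k)) = ∏ k, ∑ a, p k a * g k a := by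
  classical
  unfold prodExpect
  rw [Finset.prod_univ_sum, Fintype.piFinset_univ]
  exact Finset.sum_congr rfl fun w _ => Finset.prod_mul_distrib.symm

lemma prodExpect_mono {p : Fin n → Ω → ℝ} (hp : ∀ k a, 0 ≤ p k a) {f g : (Fin n → Ω) → ℝ}
    (h : ∀ w, f w ≤ g w) : prodExpect p f ≤ prodExpect p g :=
  Finset.sum_le_sum fun w _ =>
    mul_le_mul_of_nonneg_left (h w) (Finset.prod_nonneg fun k _ => hp k _)

lemma prodExpect_add (p : Fin n → Ω → ℝ) (f g : (Fin n → Ω) → ℝ) :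
    prodExpect p (fun w => f w + g w) = prodExpect p f + prodExpect p g := by
  simp [prodExpect, mul_add, Finset.sum_add_distrib]

lemma prodExpect_const_mul (p : Fin n → Ω → ℝ) (c : ℝ) (f : (Fin n → Ω) → ℝ) :
    prodExpect p (fun w => c * f w) = c * prodExpect p f := by
  simp [prodExpect, Finset.mul_sum, mul_left_comm]

lemma prodExpect_one {p : Fin n → Ω → ℝ} (hp : ∀ k, ∑ a, p k a = 1) :
    prodExpect p (fun _ => 1) = 1 := by
  simpa [hp] using prodExpect_prod p (fun _ _ => 1)

lemma prodExpect_const {p : Fin n → Ω → ℝ} (hp : ∀ k, ∑ a, p k a = 1) (c : ℝ) :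
    prodExpect p (fun _ => c) = c := by
  simpa [prodExpect_one hp] using prodExpect_const_mul p c (fun _ => 1)

lemma prodExpect_sum {p : Fin n → Ω → ℝ} (hp : ∀ k, ∑ a, p k a = 1) (t : Fin n → Ω → ℝ) :
    prodExpect p (fun w => ∑ k, t k (w k)) = ∑ k, ∑ a, p k a * t k a := by
  induction n with
  | zero => simp [prodExpect]
  | succ n ih =>
    rw [prodExpect_succ]
    simp only [Fin.sum_univ_succ, Fin.cons_zero, Fin.cons_succ, prodExpect_add,
      prodExpect_const fun k => hp k.succ, ih (fun k => hp k.succ), mul_add,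
      Finset.sum_add_distrib, ← Finset.sum_mul, hp, one_mul]

lemma prodExpect_sum_eq_zero {p t : Fin n → Ω → ℝ} (hp : ∀ k, ∑ a, p k a = 1)
    (ht : ∀ k, ∑ a, p k a * t k a = 0) :
    prodExpect p (fun w => ∑ k, t k (w k)) = 0 := by
  simp [prodExpect_sum hp, ht]

lemma prodExpect_prod_mul {Ω' : Type*} [Fintype Ω'] (f : Fin n → Ω → ℝ) (g : Fin n → Ω' → ℝ)
    (F : (Fin n → Ω) → ℝ) (G : (Fin n → Ω') → ℝ) :
    prodExpect (fun k (a : Ω × Ω') => f k a.1 * g k a.2)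
      (fun w => F (fun k => (w k).1) * G (fun k => (w k).2)) =
      prodExpect f F * prodExpect g G := by
  unfold prodExpect
  rw [Finset.sum_mul_sum, ← Fintype.sum_prod_type',
    ← (Equiv.arrowProdEquivProdArrow (Fin n) (fun _ => Ω) (fun _ => Ω')).sum_comp]
  refine Finset.sum_congr rfl fun w _ => ?_
  rw [Finset.prod_mul_distrib]
  exact mul_mul_mul_comm _ _ _ _

lemma prodExpect_sum_pow_two {p t : Fin n → Ω → ℝ} (hp : ∀ k, ∑ a, p k a = 1)
    (ht : ∀ k, ∑ a, p k a * t k a = 0) :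
    prodExpect p (fun w => (∑ k, t k (w k)) ^ 2) = ∑ k, ∑ a, p k a * t k a ^ 2 := by
  induction n with
  | zero => simp [prodExpect]
  | succ n ih =>
    rw [prodExpect_succ]
    have key : ∀ a, prodExpect (fun k => p (Fin.succ k))
        (fun w => (∑ k, t k ((Fin.cons a w : Fin (n + 1) → Ω) k)) ^ 2)
        = t 0 a ^ 2 + ∑ k : Fin n, ∑ a, p k.succ a * t k.succ a ^ 2 := by
      intro a
      simp only [Fin.sum_univ_succ, Fin.cons_zero, Fin.cons_succ, add_sq, prodExpect_add,
        prodExpect_const fun k => hp k.succ, prodExpect_const_mul,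
        ih (fun k => hp k.succ) (fun k => ht k.succ),
        prodExpect_sum_eq_zero (fun k => hp k.succ) (fun k => ht k.succ)]
      ring
    simp only [key, mul_add, Finset.sum_add_distrib, ← Finset.sum_mul, hp, one_mul]
    rw [Fin.sum_univ_succ]

/-- The fourth moment of a sum of independent centred variables with values in `[-b, b]`. -/
lemma prodExpect_sum_pow_four_le {p t : Fin n → Ω → ℝ} {b : ℝ} (hp : ∀ k, p k ∈ stdSimplex ℝ Ω)
    (ht : ∀ k, ∑ a, p k a * t k a = 0) (hb : ∀ k a, |t k a| ≤ b) :
    prodExpect p (fun w => (∑ k, t k (w k)) ^ 4) ≤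
      3 * (∑ k, ∑ a, p k a * t k a ^ 2) ^ 2 + b ^ 2 * ∑ k, ∑ a, p k a * t k a ^ 2 := by
  induction n with
  | zero => simp [prodExpect]
  | succ n ih =>
    rw [prodExpect_succ]
    have hp' : ∀ k : Fin n, ∑ a, p k.succ a = 1 := fun k => (hp k.succ).2
    set F := prodExpect (fun k => p (Fin.succ k)) (fun w => (∑ k : Fin n, t k.succ (w k)) ^ 4)
    set C := prodExpect (fun k => p (Fin.succ k)) (fun w => (∑ k : Fin n, t k.succ (w k)) ^ 3)
    set s := ∑ k : Fin n, ∑ a, p k.succ a * t k.succ a ^ 2 with hs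
    set v := ∑ a, p 0 a * t 0 a ^ 2 with hv
    have hF : F ≤ 3 * s ^ 2 + b ^ 2 * s :=
      ih (fun k => hp k.succ) (fun k => ht k.succ) (fun k => hb k.succ)
    have key : ∀ a, prodExpect (fun k => p (Fin.succ k))
        (fun w => (∑ k, t k ((Fin.cons a w : Fin (n + 1) → Ω) k)) ^ 4)
        = t 0 a ^ 4 + (6 * s) * t 0 a ^ 2 + (4 * C) * t 0 a + F := by
      intro a
      have e : ∀ w : Fin n → Ω, (∑ k, t k ((Fin.cons a w : Fin (n + 1) → Ω) k)) ^ 4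
          = t 0 a ^ 4 + (4 * t 0 a ^ 3) * (∑ k : Fin n, t k.succ (w k))
            + (6 * t 0 a ^ 2) * (∑ k : Fin n, t k.succ (w k)) ^ 2
            + (4 * t 0 a) * (∑ k : Fin n, t k.succ (w k)) ^ 3
            + (∑ k : Fin n, t k.succ (w k)) ^ 4 := by
        intro w
        simp only [Fin.sum_univ_succ, Fin.cons_zero, Fin.cons_succ]
        ring
      simp only [e, prodExpect_add, prodExpect_const hp', prodExpect_const_mul,
        prodExpect_sum_eq_zero hp' (fun k => ht k.succ),
        prodExpect_sum_pow_two hp' (fun k => ht k.succ)]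
      ring
    have hexp : ∑ a, p 0 a * (t 0 a ^ 4 + (6 * s) * t 0 a ^ 2 + (4 * C) * t 0 a + F)
        = ∑ a, p 0 a * t 0 a ^ 4 + 6 * s * v + F := by
      have h1 : ∑ a, p 0 a * ((4 * C) * t 0 a) = 0 := by
        simp only [mul_left_comm (p 0 _), ← Finset.mul_sum, ht 0, mul_zero]
      have h2 : ∑ a, p 0 a * ((6 * s) * t 0 a ^ 2) = 6 * s * v := by
        simp only [mul_left_comm (p 0 _), ← Finset.mul_sum, hv]
      simp only [mul_add, Finset.sum_add_distrib, h1, h2, ← Finset.sum_mul, (hp 0).2, one_mul,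
        add_zero]
    have h4 : ∑ a, p 0 a * t 0 a ^ 4 ≤ b ^ 2 * v := by
      rw [hv, Finset.mul_sum]
      refine Finset.sum_le_sum fun a _ => ?_
      have h1 : t 0 a ^ 2 ≤ b ^ 2 := sq_le_sq' (abs_le.1 (hb 0 a)).1 (abs_le.1 (hb 0 a)).2
      have h2 : 0 ≤ p 0 a * t 0 a ^ 2 := mul_nonneg ((hp 0).1 a) (sq_nonneg _)
      nlinarith [mul_le_mul_of_nonneg_left h1 h2]
    simp only [key, hexp]
    rw [Fin.sum_univ_succ]
    nlinarith [sq_nonneg v]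

/-- A quartic minorant of the indicator of `0 ≤ s` at scale `σ`. For a centred variable of variance
`σ ^ 2` and fourth moment at most `7 σ ^ 4`, taking expectations gives `P(0 ≤ s) ≥ 7 / 120`. -/
lemma quartic_le_indicator (σ s : ℝ) (hσ : 0 ≤ σ) :
    21 * σ ^ 3 * s + 14 * σ ^ 2 * s ^ 2 - s ^ 4 ≤ 120 * σ ^ 4 * (if 0 ≤ s then 1 else 0) := by
  split_ifs with h
  · nlinarith [sq_nonneg (s ^ 2 - 3 * σ * s), sq_nonneg (s ^ 2 - 9 * σ ^ 2),
      sq_nonneg (s * σ - 3 * σ ^ 2), pow_nonneg hσ 4]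
  · have h' : 0 ≤ -s := by linarith
    -- with `t = -s`, the cubic `21 σ³ - 14 σ² t + t³` is positive for `t ≥ 0`
    have : 0 ≤ 21 * σ ^ 3 - 14 * σ ^ 2 * (-s) + (-s) ^ 3 := by
      nlinarith [mul_nonneg h' (sq_nonneg (-s - 2.16 * σ)),
        mul_nonneg hσ (sq_nonneg (-s - 2.16 * σ)), pow_nonneg hσ 3,
        mul_nonneg h' (sq_nonneg σ)]
    nlinarith [mul_nonneg h' this]

/-- Independent variables with nonnegative means, whose nonzero values have absolute values in
`[δ, b]`, have a nonnegative sum with a probability bounded below in terms of `δ` and `b` only.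
If the variance of the sum is at least `b ^ 2`, this is a fourth moment bound; if the variance is
smaller and the mean is at least `2 b`, it is Chebyshev's inequality; otherwise the second moments
of the variables have a bounded sum, and the probability that all variables are nonnegative is
bounded below. -/
theorem exists_le_prodExpect_sum_nonneg (Ω : Type*) [Fintype Ω] {δ b : ℝ} (hδ : 0 < δ)
    (hb : 0 < b) :
    ∃ c : ℝ, 0 < c ∧ ∀ (n : ℕ) (p t : Fin n → Ω → ℝ), (∀ k, p k ∈ stdSimplex ℝ Ω) →
      (∀ k a, |t k a| ≤ b) → (∀ k a, t k a ≠ 0 → δ ≤ |t k a|) →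
      (∀ k, 0 ≤ ∑ a, p k a * t k a) →
      c ≤ prodExpect p (fun w => if 0 ≤ ∑ k, t k (w k) then 1 else 0) := by
  set C := (δ / (b + δ)) ^ (3 * b ^ 2 / δ ^ 2) with hC
  have hbase : 0 < δ / (b + δ) := by positivity
  have hC0 : 0 < C := Real.rpow_pos_of_pos hbase _
  refine ⟨min (7 / 120) C, by positivity, fun n p t hp hbd hgap hmean => ?_⟩
  set μ : Fin n → ℝ := fun k => ∑ a, p k a * t k a with hμ
  set u : Fin n → Ω → ℝ := fun k a => t k a - μ k with hu
  have hp1 : ∀ k, ∑ a, p k a = 1 := fun k => (hp k).2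
  have hp0 : ∀ k a, 0 ≤ p k a := fun k => (hp k).1
  have hμb : ∀ k, μ k ≤ b := by
    intro k
    calc μ k ≤ ∑ a, p k a * b :=
          Finset.sum_le_sum fun a _ => mul_le_mul_of_nonneg_left (abs_le.1 (hbd k a)).2 (hp0 k a)
      _ = b := by rw [← Finset.sum_mul, hp1, one_mul]
  have hu0 : ∀ k, ∑ a, p k a * u k a = 0 := by
    intro k
    simp only [hu, mul_sub, Finset.sum_sub_distrib, ← Finset.sum_mul, hp1, one_mul]
    simp [hμ]
  have hub : ∀ k a, |u k a| ≤ 2 * b := by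
    intro k a
    have := abs_le.1 (hbd k a)
    have h1 := hmean k
    have h2 := hμb k
    simp only [hu]
    exact abs_le.2 ⟨by linarith, by change 0 ≤ μ k at h1; linarith⟩
  set m := ∑ k, μ k with hm
  have hm0 : 0 ≤ m := Finset.sum_nonneg fun k _ => hmean k
  set v := ∑ k, ∑ a, p k a * u k a ^ 2 with hv
  have hv0 : 0 ≤ v := Finset.sum_nonneg fun k _ => Finset.sum_nonneg fun a _ =>
    mul_nonneg (hp0 k a) (sq_nonneg _)
  have hsum : ∀ w : Fin n → Ω, ∑ k, t k (w k) = ∑ k, u k (w k) + m := by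
    intro w; simp [hu, hm, Finset.sum_sub_distrib]
  have e1 := prodExpect_sum_eq_zero hp1 hu0
  have e2 := prodExpect_sum_pow_two hp1 hu0
  have e4 := prodExpect_sum_pow_four_le hp hu0 hub
  rw [← hv] at e2 e4
  rcases le_or_gt (b ^ 2) v with hvb | hvb
  · refine (min_le_left _ _).trans ?_
    have hv' : 0 < v := lt_of_lt_of_le (by positivity) hvb
    have hs2 : √v ^ 2 = v := Real.sq_sqrt hv0
    have hs4 : √v ^ 4 = v ^ 2 := by rw [show √v ^ 4 = (√v ^ 2) ^ 2 by ring, hs2]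
    have key : prodExpect p (fun w => (21 * √v ^ 3) * (∑ k, u k (w k))
          + ((14 * √v ^ 2) * (∑ k, u k (w k)) ^ 2 + (-1) * (∑ k, u k (w k)) ^ 4))
        ≤ prodExpect p (fun w => (120 * √v ^ 4) * (if 0 ≤ ∑ k, t k (w k) then 1 else 0)) := by
      refine prodExpect_mono hp0 fun w => ?_
      have h := quartic_le_indicator √v (∑ k, u k (w k)) (Real.sqrt_nonneg v)
      have h2 : (if 0 ≤ ∑ k, u k (w k) then (1 : ℝ) else 0)
          ≤ if 0 ≤ ∑ k, t k (w k) then 1 else 0 := by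
        rw [hsum w]
        split_ifs <;> linarith
      have h3 : 0 ≤ 120 * √v ^ 4 := by positivity
      nlinarith [mul_le_mul_of_nonneg_left h2 h3]
    rw [prodExpect_add, prodExpect_add, prodExpect_const_mul, prodExpect_const_mul,
      prodExpect_const_mul, prodExpect_const_mul, e1, e2, hs2, hs4] at key
    have h7 : (2 * b) ^ 2 * v ≤ 4 * v ^ 2 := by nlinarith
    have : 7 * v ^ 2 ≤
        120 * v ^ 2 * prodExpect p (fun w => if 0 ≤ ∑ k, t k (w k) then 1 else 0) := by
      nlinarith
    have hv2 : 0 < v ^ 2 := by positivity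
    nlinarith
  rcases le_or_gt (2 * b) m with hmb | hmb
  · refine (min_le_left _ _).trans ?_
    have hmp : 0 < m := by linarith
    have key : prodExpect p (fun w => 1 + (-(1 / m ^ 2)) * (∑ k, u k (w k)) ^ 2)
        ≤ prodExpect p (fun w => if 0 ≤ ∑ k, t k (w k) then 1 else 0) := by
      refine prodExpect_mono hp0 fun w => ?_
      rw [hsum w]
      split_ifs with h
      · have : 0 ≤ 1 / m ^ 2 * (∑ k, u k (w k)) ^ 2 := by positivity
        linarith
      · have : m ^ 2 ≤ (∑ k, u k (w k)) ^ 2 := by nlinarith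
        have h1 : 1 ≤ 1 / m ^ 2 * (∑ k, u k (w k)) ^ 2 := by
          rw [one_div_mul_eq_div, le_div_iff₀ (by positivity)]; linarith
        linarith
    rw [prodExpect_add, prodExpect_one hp1, prodExpect_const_mul, e2] at key
    have : 1 / m ^ 2 * v ≤ 1 / 4 := by
      rw [one_div_mul_eq_div, div_le_iff₀ (by positivity)]; nlinarith
    linarith
  · refine (min_le_right _ _).trans ?_
    -- the sum of the second moments is at most `v + b m < 3 b²`
    set P : Fin n → ℝ := fun k => ∑ a, p k a * (if t k a = 0 then 0 else 1) with hP
    have hP0 : ∀ k, 0 ≤ P k := fun k => Finset.sum_nonneg fun a _ =>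
      mul_nonneg (hp0 k a) (by split_ifs <;> norm_num)
    have hP1 : ∀ k, P k ≤ 1 := fun k => by
      rw [← hp1 k]
      refine Finset.sum_le_sum fun a _ => ?_
      have := hp0 k a
      split_ifs <;> linarith
    have hPsum : ∑ k, P k ≤ 3 * b ^ 2 / δ ^ 2 := by
      rw [le_div_iff₀ (by positivity), Finset.sum_mul]
      have h1 : ∀ k, P k * δ ^ 2 ≤ ∑ a, p k a * u k a ^ 2 + b * μ k := by
        intro k
        have h2 : ∑ a, p k a * t k a ^ 2 = ∑ a, p k a * u k a ^ 2 + μ k ^ 2 := by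
          have : ∀ a, p k a * t k a ^ 2
              = p k a * u k a ^ 2 + 2 * μ k * (p k a * u k a) + μ k ^ 2 * p k a := by
            intro a; simp only [hu]; ring
          simp only [this, Finset.sum_add_distrib, ← Finset.mul_sum, hu0, hp1]; ring
        have h3 : P k * δ ^ 2 ≤ ∑ a, p k a * t k a ^ 2 := by
          rw [hP, Finset.sum_mul]
          refine Finset.sum_le_sum fun a _ => ?_
          rw [mul_assoc]
          refine mul_le_mul_of_nonneg_left ?_ (hp0 k a)
          split_ifs with h
          · simp [h]
          · rw [one_mul, ← sq_abs (t k a)]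
            exact pow_le_pow_left₀ hδ.le (hgap k a h) 2
        nlinarith [hμb k, hmean k]
      calc ∑ k, P k * δ ^ 2 ≤ ∑ k, (∑ a, p k a * u k a ^ 2 + b * μ k) :=
            Finset.sum_le_sum fun k _ => h1 k
        _ = v + b * m := by rw [Finset.sum_add_distrib, ← Finset.mul_sum]
        _ ≤ 3 * b ^ 2 := by nlinarith
    have hone : ∀ k, (δ / (b + δ)) ^ (P k) ≤ ∑ a, p k a * (if 0 ≤ t k a then 1 else 0) := by
      intro k
      set N := ∑ a, p k a * (if 0 ≤ t k a then (1 : ℝ) else 0) with hN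
      have hbern : (1 + (-(b / (b + δ)))) ^ (P k) ≤ 1 + P k * (-(b / (b + δ))) :=
        rpow_one_add_le_one_add_mul_self
          (by rw [neg_le_neg_iff, div_le_one (by positivity)]; linarith) (hP0 k) (hP1 k)
      have heq : 1 + (-(b / (b + δ))) = δ / (b + δ) := by field_simp; ring
      rw [heq] at hbern
      refine hbern.trans ?_
      -- the mean is at most `b P(T > 0) - δ P(T < 0)`
      have h1 : μ k ≤ ∑ a, p k a * (b * (if t k a = 0 then 0 else 1)
          - (b + δ) * (1 - (if 0 ≤ t k a then 1 else 0))) := by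
        refine Finset.sum_le_sum fun a _ => mul_le_mul_of_nonneg_left ?_ (hp0 k a)
        have hab := abs_le.1 (hbd k a)
        rcases lt_trichotomy (t k a) 0 with h | h | h
        · have := hgap k a h.ne
          rw [abs_of_neg h] at this
          rw [if_neg h.ne, if_neg (not_le.2 h)]; linarith
        · simp [h]
        · rw [if_neg h.ne', if_pos h.le]; linarith
      have h2 : ∑ a, p k a * (b * (if t k a = 0 then (0 : ℝ) else 1)
          - (b + δ) * (1 - (if 0 ≤ t k a then 1 else 0))) = b * P k - (b + δ) * (1 - N) := by
        have : ∀ a, p k a * (b * (if t k a = 0 then (0 : ℝ) else 1)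
          - (b + δ) * (1 - (if 0 ≤ t k a then 1 else 0)))
          = b * (p k a * (if t k a = 0 then (0 : ℝ) else 1)) - (b + δ) * (p k a)
            + (b + δ) * (p k a * (if 0 ≤ t k a then 1 else 0)) := by intro a; ring
        simp only [this, Finset.sum_add_distrib, Finset.sum_sub_distrib, ← Finset.mul_sum, hp1]
        simp only [hP, hN]; ring
      have h3 : 0 ≤ b * P k - (b + δ) * (1 - N) := by
        rw [← h2]; exact (hmean k).trans h1
      have h4 : P k * (-(b / (b + δ))) = -(b * P k) / (b + δ) := by ring
      have h5 : -(1 - N) ≥ -(b * P k) / (b + δ) := by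
        rw [ge_iff_le, div_le_iff₀ (by positivity)]; nlinarith
      rw [h4]; linarith
    calc C ≤ (δ / (b + δ)) ^ (∑ k, P k) :=
          Real.rpow_le_rpow_of_exponent_ge hbase
            ((div_le_one (by positivity)).2 (by linarith)) hPsum
      _ = ∏ k, (δ / (b + δ)) ^ (P k) := by
          rw [Real.rpow_sum_of_pos hbase]
      _ ≤ ∏ k, ∑ a, p k a * (if 0 ≤ t k a then 1 else 0) :=
          Finset.prod_le_prod (fun k _ => Real.rpow_nonneg hbase.le _) fun k _ => hone k
      _ = prodExpect p (fun w => ∏ k, (if 0 ≤ t k (w k) then 1 else 0)) :=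
          (prodExpect_prod p _).symm
      _ ≤ _ := by
          refine prodExpect_mono hp0 fun w => ?_
          by_cases h : ∀ k, 0 ≤ t k (w k)
          · rw [if_pos (Finset.sum_nonneg fun k _ => h k)]
            simp [h]
          · obtain ⟨k, hk⟩ := not_forall.1 h
            rw [Finset.prod_eq_zero (Finset.mem_univ k) (if_neg hk)]
            split_ifs <;> norm_num

end prodExpect

/-! ### Expectations of extended-real functions -/

lemma coe_sum_ereal {A : Type*} (s : Finset A) (g : A → ℝ) :
    ((∑ a ∈ s, g a : ℝ) : EReal) = ∑ a ∈ s, (g a : EReal) :=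
  map_sum (⟨⟨Real.toEReal, EReal.coe_zero⟩, EReal.coe_add⟩ : ℝ →+ EReal) g s

lemma sum_eq_bot {A : Type*} {s : Finset A} {f : A → EReal} {a : A} (ha : a ∈ s)
    (hf : f a = ⊥) : ∑ a ∈ s, f a = ⊥ := by
  classical
  rw [← Finset.add_sum_erase s f ha, hf, EReal.bot_add]

section expect

variable {A : Type*} [Fintype A] {p : A → ℝ} {f : A → EReal}

lemma expect_eq_coe (hf : ∀ a, f a ≠ ⊤) (h : ∀ a, p a ≠ 0 → f a ≠ ⊥) :
    expect p f = ((∑ a, p a * (f a).toReal : ℝ) : EReal) := by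
  rw [expect, coe_sum_ereal]
  refine Finset.sum_congr rfl fun a _ => ?_
  by_cases hp : p a = 0
  · simp [hp]
  · rw [EReal.coe_mul, EReal.coe_toReal (hf a) (h a hp)]

lemma expect_eq_bot {a : A} (hp : 0 < p a) (hf : f a = ⊥) : expect p f = ⊥ :=
  sum_eq_bot (Finset.mem_univ a) (by rw [hf, EReal.coe_mul_bot_of_pos hp])

end expect

/-! ### The pairwise form of the single-letter condition -/

section coupling

variable {U X Y Z : Type*} [Fintype U] [Fintype X] [Fintype Y] [Fintype Z]

/-- Expectations of functions of `(X, Y, Z)` under a joint law `J` with marginal `P × V`. -/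
lemma sum_mul_of_marginal {P : X → ℝ} {V : X → Y × Z → ℝ} {J : U × X × X × Z × Y → ℝ}
    (h : ∀ x z y, ∑ u, ∑ x', J (u, x', x, z, y) = P x * V x (y, z)) (f : X × Y × Z → ℝ) :
    ∑ a, J a * f (a.2.2.1, a.2.2.2.2, a.2.2.2.1) = ∑ a : X × Y × Z, P a.1 * V a.1 a.2 * f a := by
  have e : ∀ x, ∑ y, ∑ z, P x * V x (y, z) * f (x, y, z)
      = ∑ u, ∑ x', ∑ z, ∑ y, J (u, x', x, z, y) * f (x, y, z) := by
    intro x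
    rw [Finset.sum_comm]
    simp only [← h, Finset.sum_mul]
    calc _ = ∑ z, ∑ u, ∑ x', ∑ y, J (u, x', x, z, y) * f (x, y, z) := by
          refine Finset.sum_congr rfl fun z _ => ?_
          rw [Finset.sum_comm]
          exact Finset.sum_congr rfl fun u _ => Finset.sum_comm
      _ = _ := by
          rw [Finset.sum_comm]
          exact Finset.sum_congr rfl fun u _ => Finset.sum_comm
  simp only [Fintype.sum_prod_type, e]
  symm
  rw [Finset.sum_comm]
  exact Finset.sum_congr rfl fun u _ => Finset.sum_comm

/-- A joint law in which `Y` is produced from `(X, Z)` by `V`, independently of `(U, X̃)`: the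
remaining requirements concern the factor `g` only. -/
lemma isCoupling_mul {P : X → ℝ} {V : X → Y × Z → ℝ} (hP : P ∈ stdSimplex ℝ X) (hV : IsChannel V)
    {g : U → X → X → Z → ℝ} (hg : ∀ u x' x z, 0 ≤ g u x' x z)
    (hmarg : ∀ x z, ∑ u, ∑ x', g u x' x z = P x)
    (hsymm : ∀ u x₁ x₂ z, g u x₁ x₂ z * ∑ y, V x₂ (y, z) = g u x₂ x₁ z * ∑ y, V x₁ (y, z))
    (hmarkov : IsMarkov fun (x' : X) (uz : U × Z) (x : X) =>
      g uz.1 x' x uz.2 * ∑ y, V x (y, uz.2)) :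
    IsCoupling P V
      (fun a : U × X × X × Z × Y =>
        g a.1 a.2.1 a.2.2.1 a.2.2.2.1 * V a.2.2.1 (a.2.2.2.2, a.2.2.2.1)) := by
  have hm : ∀ x z y, ∑ u, ∑ x', g u x' x z * V x (y, z) = P x * V x (y, z) := by
    intro x z y
    simp only [← Finset.sum_mul, hmarg]
  refine ⟨⟨fun a => mul_nonneg (hg _ _ _ _) ((hV _).1 _), ?_⟩, hm, ?_, ?_, ?_⟩
  · have := sum_mul_of_marginal (J := fun a : U × X × X × Z × Y =>
        g a.1 a.2.1 a.2.2.1 a.2.2.2.1 * V a.2.2.1 (a.2.2.2.2, a.2.2.2.1)) hm (fun _ => 1)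
    simp only [mul_one] at this
    rw [this, Fintype.sum_prod_type]
    simp only [← Finset.mul_sum, (hV _).2, mul_one]
    exact hP.2
  · intro u x₁ x₂ z
    simpa only [Finset.mul_sum] using hsymm u x₁ x₂ z
  · simpa only [Finset.mul_sum] using hmarkov
  · rintro ⟨x', u⟩ ⟨x, z⟩ y
    simp only [← Finset.mul_sum, ← Finset.sum_mul]
    ring

lemma IsCoupling.reindex {U' : Type*} [Fintype U'] {P : X → ℝ} {V : X → Y × Z → ℝ}
    {J : U × X × X × Z × Y → ℝ} (hJ : IsCoupling P V J) (e : U' ≃ U) :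
    IsCoupling P V (fun a : U' × X × X × Z × Y => J (e a.1, a.2)) := by
  refine ⟨⟨fun a => hJ.mem_simplex.1 _, ?_⟩, fun x z y => ?_, fun u => hJ.symmetric (e u),
    fun x' uz x => hJ.markov_input x' (e uz.1, uz.2) x, fun xu xz y => ?_⟩
  · rw [← hJ.mem_simplex.2]
    exact (e.prodCongr (Equiv.refl (X × X × Z × Y))).sum_comp J
  · rw [← hJ.marginal x z y]
    exact e.sum_comp fun u => ∑ x', J (u, x', x, z, y)
  · have h := hJ.markov_output (xu.1, e xu.2) xz y
    have e1 : ∀ y, ∑ a : X × U', J (e a.2, a.1, xz.1, xz.2, y)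
        = ∑ a : X × U, J (a.2, a.1, xz.1, xz.2, y) := fun y =>
      ((Equiv.refl X).prodCongr e).sum_comp fun a : X × U => J (a.2, a.1, xz.1, xz.2, y)
    have e2 : ∑ a : X × U', ∑ y, J (e a.2, a.1, xz.1, xz.2, y)
        = ∑ a : X × U, ∑ y, J (a.2, a.1, xz.1, xz.2, y) :=
      ((Equiv.refl X).prodCongr e).sum_comp fun a : X × U => ∑ y, J (a.2, a.1, xz.1, xz.2, y)
    simpa only [e1, e2] using h

lemma expect_reindex {U' A : Type*} [Fintype U'] [Fintype A] (J : U × A → ℝ) (f : A → EReal)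
    (e : U' ≃ U) :
    expect (fun a : U' × A => J (e a.1, a.2)) (fun a => f a.2) = expect J fun a => f a.2 :=
  (e.prodCongr (Equiv.refl A)).sum_comp fun a : U × A => (J a : EReal) * f a.2

/-- The law of `Z` given `X`. -/
noncomputable def channelZ (V : X → Y × Z → ℝ) (x : X) (z : Z) : ℝ := ∑ y, V x (y, z)

open Classical in
/-- The factor of the law of `(U, X̃, X, Z)` for the coupling that perturbs `X̃ = X` at the output
`z₀` only. Under `U = some x`, both `X̃` and `X` equal `x`. The value `U = none` has mass
`2 l`, occurs at `Z = z₀` only, and makes `X̃` and `X` independent and uniform on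
`{x₁, x₂}`. -/
noncomputable def pairKernel (P : X → ℝ) (V : X → Y × Z → ℝ) (x₁ x₂ : X) (z₀ : Z) (l : ℝ) :
    Option X → X → X → Z → ℝ
  | none, x', x, z =>
      if z = z₀ ∧ (x = x₁ ∨ x = x₂) ∧ (x' = x₁ ∨ x' = x₂) then l / channelZ V x z₀ / 2 else 0
  | some u, x', x, z =>
      if x' = u ∧ x = u then
        P x - (if z = z₀ ∧ (x = x₁ ∨ x = x₂) then l / channelZ V x z₀ else 0) else 0

lemma isCoupling_pairKernel {P : X → ℝ} {V : X → Y × Z → ℝ} (hP : P ∈ stdSimplex ℝ X)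
    (hV : IsChannel V) {x₁ x₂ : X} (hne : x₁ ≠ x₂) {z₀ : Z} (hz₁ : 0 < channelZ V x₁ z₀)
    (hz₂ : 0 < channelZ V x₂ z₀) {l : ℝ} (hl : 0 ≤ l) (hl₁ : l ≤ P x₁ * channelZ V x₁ z₀)
    (hl₂ : l ≤ P x₂ * channelZ V x₂ z₀) :
    IsCoupling P V
      (fun a : Option X × X × X × Z × Y =>
        pairKernel P V x₁ x₂ z₀ l a.1 a.2.1 a.2.2.1 a.2.2.2.1 *
          V a.2.2.1 (a.2.2.2.2, a.2.2.2.1)) := by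
  classical
  have hpos : ∀ x, x = x₁ ∨ x = x₂ → 0 < channelZ V x z₀ := by
    rintro x (rfl | rfl) <;> assumption
  have hle : ∀ x, x = x₁ ∨ x = x₂ → l / channelZ V x z₀ ≤ P x := by
    rintro x (rfl | rfl)
    · rwa [div_le_iff₀ hz₁]
    · rwa [div_le_iff₀ hz₂]
  have hpair : ∀ c : ℝ, ∑ x', (if x' = x₁ ∨ x' = x₂ then c else 0) = 2 * c := by
    intro c
    rw [← Finset.sum_filter, Finset.sum_const]
    have : Finset.univ.filter (fun x' => x' = x₁ ∨ x' = x₂) = {x₁, x₂} := by ext; simp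
    rw [this, Finset.card_pair hne]; simp
  refine isCoupling_mul hP hV ?_ ?_ ?_ ?_
  · rintro (_ | u) x' x z
    · simp only [pairKernel]
      split_ifs with h
      · have := hpos x h.2.1; positivity
      · exact le_rfl
    · simp only [pairKernel]
      split_ifs with h h'
      · linarith [hle x h'.2]
      · linarith [hP.1 x]
      · exact le_rfl
  · intro x z
    rw [Fintype.sum_option]
    have h1 : ∑ u, ∑ x', pairKernel P V x₁ x₂ z₀ l (some u) x' x z
        = P x - (if z = z₀ ∧ (x = x₁ ∨ x = x₂) then l / channelZ V x z₀ else 0) := by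
      simp only [pairKernel, ite_and]
      simp
    rw [h1]
    simp only [pairKernel]
    by_cases h : z = z₀ ∧ (x = x₁ ∨ x = x₂)
    · simp only [h.1, h.2, true_and, hpair, if_true]; ring
    · have : ∀ x', ¬ (z = z₀ ∧ (x = x₁ ∨ x = x₂) ∧ (x' = x₁ ∨ x' = x₂)) :=
        fun x' h' => h ⟨h'.1, h'.2.1⟩
      simp [h, this]
  · rintro (_ | u) a b z
    · by_cases h : z = z₀ ∧ (b = x₁ ∨ b = x₂) ∧ (a = x₁ ∨ a = x₂)
      · have h' : z = z₀ ∧ (a = x₁ ∨ a = x₂) ∧ (b = x₁ ∨ b = x₂) := ⟨h.1, h.2.2, h.2.1⟩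
        have ha := (hpos a h.2.2).ne'
        have hb := (hpos b h.2.1).ne'
        simp only [pairKernel, if_pos h, if_pos h']
        rw [h.1, ← channelZ, ← channelZ]
        field_simp
      · have h' : ¬ (z = z₀ ∧ (a = x₁ ∨ a = x₂) ∧ (b = x₁ ∨ b = x₂)) :=
          fun h' => h ⟨h'.1, h'.2.2, h'.2.1⟩
        simp only [pairKernel, if_neg h, if_neg h', zero_mul]
    · by_cases h : a = u ∧ b = u
      · rw [h.1, h.2]
      · have h' : ¬ (b = u ∧ a = u) := fun h' => h h'.symm
        simp only [pairKernel, if_neg h, if_neg h', zero_mul]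
  · rintro a ⟨_ | u, z⟩ b
    · -- given `none`, the law is the product `(l / 2) 1{x'} 1{x}`
      have e : ∀ x' x, pairKernel P V x₁ x₂ z₀ l none x' x z * ∑ y, V x (y, z)
          = (if z = z₀ then l / 2 else 0) * (if x' = x₁ ∨ x' = x₂ then 1 else 0)
            * (if x = x₁ ∨ x = x₂ then 1 else 0) := by
        intro x' x
        by_cases hz : z = z₀
        · by_cases hx : x = x₁ ∨ x = x₂
          · by_cases hx' : x' = x₁ ∨ x' = x₂
            · have := (hpos x hx).ne'
              simp only [pairKernel, hz, hx, hx', true_and, if_true]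
              rw [← channelZ]
              field_simp
            · simp [pairKernel, hx']
          · simp [pairKernel, hx]
        · simp [pairKernel, hz]
      simp only [e, ← Finset.mul_sum, ← Finset.sum_mul]
      ring
    · have e : ∀ x' x, pairKernel P V x₁ x₂ z₀ l (some u) x' x z * ∑ y, V x (y, z)
          = (if x' = u then 1 else 0) * (if x = u then
            (P u - (if z = z₀ ∧ (u = x₁ ∨ u = x₂) then l / channelZ V u z₀ else 0))
              * ∑ y, V u (y, z) else 0) := by
        intro x' x
        by_cases hx' : x' = u
        · by_cases hx : x = u
          · subst hx; simp [pairKernel, hx']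
          · simp [pairKernel, hx]
        · simp [pairKernel, hx']
      simp only [e, ← Finset.mul_sum, ← Finset.sum_mul]
      ring

variable {q : X → Y → EReal} {P : X → ℝ} {V : X → Y × Z → ℝ}

lemma ne_bot_of_expect_ne_bot (hP : ∀ x, 0 ≤ P x) (hV : IsChannel V)
    (hbot : expect (fun a : X × Y × Z => P a.1 * V a.1 a.2) (fun a => q a.1 a.2.1) ≠ ⊥)
    {x : X} {y : Y} {z : Z} (hx : P x ≠ 0) (hv : V x (y, z) ≠ 0) : q x y ≠ ⊥ := by
  intro h
  refine hbot (expect_eq_bot (a := (x, y, z)) ?_ h)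
  exact mul_pos (lt_of_le_of_ne (hP x) hx.symm) (lt_of_le_of_ne ((hV x).1 _) hv.symm)

/-- Testing the condition that defines `channelSet` on the laws of `pairKernel` decouples it into
one condition for each output `z` and each pair of inputs: on average over `Y`, exchanging the two
inputs does not decrease the metric. -/
theorem channelSet_pairwise (hq : ∀ x y, q x y ≠ ⊤) (hP : P ∈ stdSimplex ℝ X)
    (hVq : V ∈ channelSet q P)
    (hbot : expect (fun a : X × Y × Z => P a.1 * V a.1 a.2) (fun a => q a.1 a.2.1) ≠ ⊥)
    {x₁ x₂ : X} (hne : x₁ ≠ x₂) (hx₁ : 0 < P x₁) (hx₂ : 0 < P x₂) {z : Z}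
    (hz₁ : 0 < channelZ V x₁ z) (hz₂ : 0 < channelZ V x₂ z) :
    (∀ y, V x₁ (y, z) ≠ 0 → q x₂ y ≠ ⊥) ∧
    0 ≤ channelZ V x₂ z * ∑ y, V x₁ (y, z) * ((q x₂ y).toReal - (q x₁ y).toReal)
      + channelZ V x₁ z * ∑ y, V x₂ (y, z) * ((q x₁ y).toReal - (q x₂ y).toReal) := by
  classical
  obtain ⟨hV, hinf⟩ := hVq
  have hfin : ∀ x y z, P x ≠ 0 → V x (y, z) ≠ 0 → q x y ≠ ⊥ := fun x y z hx hv =>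
    ne_bot_of_expect_ne_bot hP.1 hV hbot hx hv
  set l := min (P x₁ * channelZ V x₁ z) (P x₂ * channelZ V x₂ z) with hl
  have hl0 : 0 < l := lt_min (mul_pos hx₁ hz₁) (mul_pos hx₂ hz₂)
  set K := pairKernel P V x₁ x₂ z l with hK
  set J : Option X × X × X × Z × Y → ℝ := fun a =>
        K a.1 a.2.1 a.2.2.1 a.2.2.2.1 * V a.2.2.1 (a.2.2.2.2, a.2.2.2.1) with hJdef
  have hJ : IsCoupling P V J := isCoupling_pairKernel hP hV hne hz₁ hz₂ hl0.le
    (min_le_left _ _) (min_le_right _ _)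
  -- two distinct inputs make room for `card X + 1` values of `U`
  have hcard : Fintype.card (Option X) ≤ Fintype.card X ^ 2 * Fintype.card Z := by
    have h2 : 2 ≤ Fintype.card X := by
      have := Finset.card_le_univ {x₁, x₂}
      rwa [Finset.card_pair hne] at this
    have h1 : 1 ≤ Fintype.card Z := Fintype.card_pos_iff.2 ⟨z⟩
    rw [Fintype.card_option]
    nlinarith [Nat.mul_le_mul_left (Fintype.card X ^ 2) h1]
  have hle : expect (fun a : X × Y × Z => P a.1 * V a.1 a.2) (fun a => q a.1 a.2.1)
      ≤ expect J (fun a => q a.2.1 a.2.2.2.2) := by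
    refine hinf.trans ((iInf₂_le (Fintype.card (Option X)) hcard).trans ((iInf₂_le _ (hJ.reindex
      (Fintype.equivFin (Option X)).symm)).trans_eq ?_))
    exact expect_reindex J (fun a : X × X × Z × Y => q a.1 a.2.2.2) _
  have hJbot : ∀ a, J a ≠ 0 → q a.2.1 a.2.2.2.2 ≠ ⊥ := by
    intro a ha hb
    have : expect J (fun a => q a.2.1 a.2.2.2.2) = ⊥ :=
      expect_eq_bot (lt_of_le_of_ne (hJ.mem_simplex.1 a) ha.symm) hb
    exact hbot (le_bot_iff.1 (hle.trans this.le))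
  refine ⟨fun y hy => ?_, ?_⟩
  · refine hJbot (none, x₂, x₁, z, y) (mul_ne_zero ?_ hy)
    simp only [hK, pairKernel]
    rw [if_pos (by simp)]
    positivity
  have hr : ∑ a : X × Y × Z, P a.1 * V a.1 a.2 * (q a.1 a.2.1).toReal
      ≤ ∑ a, J a * (q a.2.1 a.2.2.2.2).toReal := by
    rw [expect_eq_coe (fun a => hq _ _) hJbot, expect_eq_coe (fun a => hq _ _)
      (fun a ha => hfin _ _ a.2.2 (left_ne_zero_of_mul ha) (right_ne_zero_of_mul ha))] at hle
    exact_mod_cast hle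
  rw [← sum_mul_of_marginal hJ.marginal (fun a => (q a.1 a.2.1).toReal), ← sub_nonneg,
    ← Finset.sum_sub_distrib] at hr
  simp only [← mul_sub] at hr
  rw [Fintype.sum_prod_type, Fintype.sum_option] at hr
  have hsome : ∑ u, ∑ a : X × X × Z × Y, J (some u, a) *
      ((q a.1 a.2.2.2).toReal - (q a.2.1 a.2.2.2).toReal) = 0 := by
    refine Finset.sum_eq_zero fun u _ => Finset.sum_eq_zero fun a _ => ?_
    by_cases h : a.1 = u ∧ a.2.1 = u
    · rw [h.1, h.2, sub_self, mul_zero]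
    · simp only [hJdef, hK, pairKernel, if_neg h, zero_mul]
  rw [hsome, add_zero] at hr
  simp only [Fintype.sum_prod_type] at hr
  have hnone : ∑ x', ∑ x, ∑ z', ∑ y, J (none, x', x, z', y) *
      ((q x' y).toReal - (q x y).toReal) =
      l / channelZ V x₁ z / 2 * ∑ y, V x₁ (y, z) * ((q x₂ y).toReal - (q x₁ y).toReal)
      + l / channelZ V x₂ z / 2 * ∑ y, V x₂ (y, z) * ((q x₁ y).toReal - (q x₂ y).toReal) := by
    have e : ∀ x' x, ∑ z', ∑ y, J (none, x', x, z', y) * ((q x' y).toReal - (q x y).toReal)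
        = if x' = x₁ ∨ x' = x₂ then if x = x₁ ∨ x = x₂ then l / channelZ V x z / 2 *
          ∑ y, V x (y, z) * ((q x' y).toReal - (q x y).toReal) else 0 else 0 := by
      intro x' x
      rw [Finset.sum_eq_single z]
      · by_cases hx' : x' = x₁ ∨ x' = x₂
        · by_cases hx : x = x₁ ∨ x = x₂
          · simp only [hJdef, hK, pairKernel, hx, hx', true_and, if_true, Finset.mul_sum,
              mul_assoc]
          · simp [hJdef, hK, pairKernel, hx]
        · simp [hJdef, hK, pairKernel, hx']
      · intro z' _ hz'
        simp [hJdef, hK, pairKernel, hz']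
      · simp
    have hpair : ∀ f : X → ℝ, ∑ x, (if x = x₁ ∨ x = x₂ then f x else 0) = f x₁ + f x₂ := by
      intro f
      rw [← Finset.sum_filter]
      have : Finset.univ.filter (fun x' => x' = x₁ ∨ x' = x₂) = {x₁, x₂} := by ext; simp
      rw [this, Finset.sum_pair hne]
    have hpair' : ∀ x', (∑ x, if x' = x₁ ∨ x' = x₂ then if x = x₁ ∨ x = x₂ then
          l / channelZ V x z / 2 *
          ∑ y, V x (y, z) * ((q x' y).toReal - (q x y).toReal) else 0 else 0)
        = if x' = x₁ ∨ x' = x₂ then (∑ x, if x = x₁ ∨ x = x₂ then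
          l / channelZ V x z / 2 *
          ∑ y, V x (y, z) * ((q x' y).toReal - (q x y).toReal) else 0) else 0 := by
      intro x'; split_ifs <;> simp
    simp only [e, hpair', hpair, sub_self, mul_zero, Finset.sum_const_zero, zero_add, add_zero]
    ring
  rw [hnone] at hr
  have h1 := mul_nonneg (mul_nonneg hr (mul_pos hz₁ hz₂).le) (by positivity : 0 ≤ 2 / l)
  refine h1.trans_eq ?_
  have := hz₁.ne'
  have := hz₂.ne'
  field_simp

end coupling

/-! ### Mutual information and a Fano inequality -/

section fano

variable {X Z : Type*} [Fintype Z] {ι : Type*}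

lemma log_div_ge_sub {a b : ℝ} (ha : 0 ≤ a) (hb : 0 ≤ b) (hab : a ≠ 0 → b ≠ 0) :
    a - b ≤ a * Real.log (a / b) := by
  rcases ha.eq_or_lt with rfl | ha
  · simpa using hb
  have hb' : 0 < b := lt_of_le_of_ne hb (hab ha.ne').symm
  have h := Real.log_le_sub_one_of_pos (div_pos hb' ha)
  have h2 : Real.log (a / b) = -Real.log (b / a) := by rw [← Real.log_inv, inv_div]
  rw [h2]
  have h3 : a * Real.log (b / a) ≤ a * (b / a - 1) := mul_le_mul_of_nonneg_left h ha.le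
  have h4 : a * (b / a - 1) = b - a := by field_simp
  linarith

lemma mutualInfo_nonneg [Fintype X] {p : X → Z → ℝ} (hp : ∀ a b, 0 ≤ p a b)
    (hsum : ∑ a, ∑ b, p a b = 1) :
    0 ≤ mutualInfo p := by
  have h : ∑ a, ∑ b, (p a b - (∑ b', p a b') * ∑ a', p a' b) ≤ mutualInfo p := by
    refine Finset.sum_le_sum fun a _ => Finset.sum_le_sum fun b _ => ?_
    refine log_div_ge_sub (hp a b) (mul_nonneg (Finset.sum_nonneg fun b' _ => hp a b')
      (Finset.sum_nonneg fun a' _ => hp a' b)) fun hab => mul_ne_zero ?_ ?_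
    · exact (Finset.sum_pos' (fun b' _ => hp a b')
        ⟨b, Finset.mem_univ b, lt_of_le_of_ne (hp a b) hab.symm⟩).ne'
    · exact (Finset.sum_pos' (fun a' _ => hp a' b)
        ⟨a, Finset.mem_univ a, lt_of_le_of_ne (hp a b) hab.symm⟩).ne'
  refine le_trans (le_of_eq ?_) h
  simp only [Finset.sum_sub_distrib, ← Finset.mul_sum, ← Finset.sum_mul]
  rw [Finset.sum_comm (f := fun y x => p x y), hsum]
  norm_num

lemma mutualInfo_mul [Fintype X] {P : X → ℝ} {T : X → Z → ℝ} (hT : IsChannel T) :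
    mutualInfo (fun a b => P a * T a b) =
      ∑ a, P a * ∑ b, T a b * Real.log (T a b / ∑ a', P a' * T a' b) := by
  unfold mutualInfo
  refine Finset.sum_congr rfl fun a _ => ?_
  rw [Finset.mul_sum]
  refine Finset.sum_congr rfl fun b _ => ?_
  by_cases hP : P a = 0
  · simp [hP]
  · rw [← Finset.mul_sum, (hT a).2, mul_one, mul_div_mul_left _ _ hP, mul_assoc]

open Classical in
/-- The average of the empirical distributions of the words `x m`, `m ∈ S`. -/
noncomputable def wordLaw {n : ℕ} (S : Finset ι) (x : ι → Fin n → X) (a : X) : ℝ :=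
  (∑ m ∈ S, ∑ k, if x m k = a then (1 : ℝ) else 0) / (S.card * n)

variable {n : ℕ} {S : Finset ι} {x : ι → Fin n → X}

lemma sum_wordLaw_mul [Fintype X] (f : X → ℝ) :
    ∑ a, wordLaw S x a * f a = (∑ m ∈ S, ∑ k, f (x m k)) / (S.card * n) := by
  classical
  simp only [wordLaw, div_mul_eq_mul_div, ← Finset.sum_div, Finset.sum_mul]
  congr 1
  rw [Finset.sum_comm]
  refine Finset.sum_congr rfl fun m _ => ?_
  rw [Finset.sum_comm]
  exact Finset.sum_congr rfl fun k _ => by simp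

lemma wordLaw_mem_stdSimplex [Fintype X] (hS : S.Nonempty) (hn : 0 < n) :
    wordLaw S x ∈ stdSimplex ℝ X := by
  have hS' : (0 : ℝ) < S.card := by exact_mod_cast hS.card_pos
  have hn' : (0 : ℝ) < n := by exact_mod_cast hn
  constructor
  · intro a
    unfold wordLaw
    refine div_nonneg (Finset.sum_nonneg fun m _ => Finset.sum_nonneg fun k _ => ?_)
      (by positivity)
    split_ifs <;> norm_num
  · have := sum_wordLaw_mul (S := S) (x := x) (fun _ => 1)
    simp only [mul_one] at this
    rw [this]
    simp only [Finset.sum_const, Finset.card_univ, Fintype.card_fin, nsmul_eq_mul, mul_one]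
    exact div_self (by positivity)

lemma wordLaw_pos {m : ι} (hm : m ∈ S) (k : Fin n) : 0 < wordLaw S x (x m k) := by
  classical
  have hS' : (0 : ℝ) < S.card := by exact_mod_cast Finset.card_pos.2 ⟨m, hm⟩
  have hn' : (0 : ℝ) < n := by exact_mod_cast k.pos
  have h0 : ∀ m' k', (0 : ℝ) ≤ if x m' k' = x m k then 1 else 0 := by
    intro m' k'; split_ifs <;> norm_num
  refine div_pos (Finset.sum_pos' (fun m' _ => Finset.sum_nonneg fun k' _ => h0 m' k')
    ⟨m, hm, Finset.sum_pos' (fun k' _ => h0 m k') ⟨k, Finset.mem_univ k, by simp⟩⟩)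
    (by positivity)

lemma exists_of_wordLaw_ne_zero {a : X} (h : wordLaw S x a ≠ 0) : ∃ m ∈ S, ∃ k, x m k = a := by
  classical
  by_contra! hne
  refine h ?_
  unfold wordLaw
  rw [Finset.sum_eq_zero fun m hm => Finset.sum_eq_zero fun k _ => if_neg (hne m hm k), zero_div]

lemma blockChannel_nonneg {T : X → Z → ℝ} (hT : IsChannel T) (w : Fin n → X) (z : Fin n → Z) :
    0 ≤ blockChannel T w z :=
  Finset.prod_nonneg fun _ _ => (hT _).1 _

lemma sum_blockChannel {T : X → Z → ℝ} (hT : IsChannel T) (w : Fin n → X) :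
    ∑ z, blockChannel T w z = 1 := by
  simpa [prodExpect, blockChannel] using
    prodExpect_one (p := fun k => T (w k)) fun k => (hT (w k)).2

lemma mul_mutualInfo_wordLaw [Fintype X] {T : X → Z → ℝ} (hT : IsChannel T)
    (hS : S.Nonempty) (hn : 0 < n) :
    (S.card : ℝ) * (n * mutualInfo (fun a b => wordLaw S x a * T a b)) =
      ∑ m ∈ S, ∑ z, blockChannel T (x m) z *
        Real.log (blockChannel T (x m) z / ∏ k, ∑ a, wordLaw S x a * T a (z k)) := by
  have hS' : (0 : ℝ) < S.card := by exact_mod_cast hS.card_pos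
  have hn' : (0 : ℝ) < n := by exact_mod_cast hn
  set Q : Z → ℝ := fun b => ∑ a, wordLaw S x a * T a b with hQ
  have hw := wordLaw_mem_stdSimplex (x := x) hS hn
  rw [mutualInfo_mul hT, sum_wordLaw_mul, ← mul_assoc, mul_div_cancel₀ _ (by positivity)]
  refine Finset.sum_congr rfl fun m hm => ?_
  rw [← prodExpect_sum (p := fun k => T (x m k)) (fun k => (hT (x m k)).2)
    (fun k b => Real.log (T (x m k) b / Q b))]
  refine Finset.sum_congr rfl fun z _ => ?_
  change blockChannel T (x m) z * _ = _
  by_cases h0 : blockChannel T (x m) z = 0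
  · simp [h0]
  · have hz : ∀ k, T (x m k) (z k) ≠ 0 := fun k =>
      Finset.prod_ne_zero_iff.1 h0 k (Finset.mem_univ k)
    have hQz : ∀ k, Q (z k) ≠ 0 := fun k => by
      refine (Finset.sum_pos' (fun a _ => mul_nonneg (hw.1 a) ((hT a).1 _))
        ⟨x m k, Finset.mem_univ _, ?_⟩).ne'
      exact mul_pos (wordLaw_pos hm k) (lt_of_le_of_ne ((hT _).1 _) (hz k).symm)
    rw [blockChannel, ← Finset.prod_div_distrib,
      Real.log_prod fun k _ => div_ne_zero (hz k) (hQz k)]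

/-- Fano's inequality, for the decoder of the output `z` that draws a message from its posterior
law: the double sum on the left is `K` times the probability that it recovers the message, where
`K` is the number of messages. The proof is Gibbs' inequality for the joint law of message and
output against `Qⁿ(z) K ^ π(m | z) / (2 K)`, where `Q` is the output law for one letter and `π` the
posterior. -/
theorem fano_le [Fintype X] {T : X → Z → ℝ} (hT : IsChannel T) (hS : S.Nonempty) (hn : 0 < n) :
    Real.log S.card * ∑ m ∈ S, ∑ z, blockChannel T (x m) z *
        (blockChannel T (x m) z / ∑ m' ∈ S, blockChannel T (x m') z) - S.card * Real.log 2 ≤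
      (S.card : ℝ) * (n * mutualInfo (fun a b => wordLaw S x a * T a b)) := by
  have hS1 : (1 : ℝ) ≤ S.card := by exact_mod_cast hS.card_pos
  have hS' : (0 : ℝ) < S.card := by linarith
  set K : ℝ := (S.card : ℝ) with hK
  set Q : Z → ℝ := fun b => ∑ a, wordLaw S x a * T a b with hQ
  have hw := wordLaw_mem_stdSimplex (x := x) hS hn
  have hQch : Q ∈ stdSimplex ℝ Z := by
    refine ⟨fun b => Finset.sum_nonneg fun a _ => mul_nonneg (hw.1 a) ((hT a).1 _), ?_⟩
    rw [hQ, Finset.sum_comm]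
    simp only [← Finset.mul_sum, (hT _).2, mul_one, hw.2]
  set v : ι → (Fin n → Z) → ℝ := fun m z => blockChannel T (x m) z with hv
  set s : (Fin n → Z) → ℝ := fun z => ∑ m' ∈ S, v m' z with hs
  set q : (Fin n → Z) → ℝ := fun z => ∏ k, Q (z k) with hq
  have hv0 : ∀ m z, 0 ≤ v m z := fun m z => blockChannel_nonneg hT _ _
  have hs0 : ∀ z, 0 ≤ s z := fun z => Finset.sum_nonneg fun m _ => hv0 m z
  have hq0 : ∀ z, 0 ≤ q z := fun z => Finset.prod_nonneg fun k _ => hQch.1 _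
  have hq1 : ∑ z, q z = 1 := by
    simpa [prodExpect] using prodExpect_one (n := n) (p := fun _ => Q) fun _ => hQch.2
  have hqv : ∀ m ∈ S, ∀ z, v m z ≠ 0 → q z ≠ 0 := by
    intro m hm z h
    refine Finset.prod_ne_zero_iff.2 fun k _ => ?_
    refine (Finset.sum_pos' (fun a _ => mul_nonneg (hw.1 a) ((hT a).1 _))
        ⟨x m k, Finset.mem_univ _, ?_⟩).ne'
    exact mul_pos (wordLaw_pos hm k) (lt_of_le_of_ne ((hT _).1 _)
      (Finset.prod_ne_zero_iff.1 h k (Finset.mem_univ k)).symm)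
  rw [mul_mutualInfo_wordLaw hT hS hn]
  have hterm : ∀ m ∈ S, ∀ z, v m z - q z * K ^ (v m z / s z) / 2 ≤
      v m z * Real.log (v m z / q z) + v m z * Real.log 2
        - Real.log K * (v m z * (v m z / s z)) := by
    intro m hm z
    have hpow : 0 < K ^ (v m z / s z) := Real.rpow_pos_of_pos hS' _
    refine (log_div_ge_sub (hv0 m z) (b := q z * K ^ (v m z / s z) / 2)
      (by have := hq0 z; positivity) fun h => ?_).trans_eq ?_
    · have := hqv m hm z h
      positivity
    · by_cases h : v m z = 0
      · simp [h]
      · have hq' := hqv m hm z h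
        have : v m z / (q z * K ^ (v m z / s z) / 2)
            = v m z / q z * 2 / K ^ (v m z / s z) := by field_simp
        rw [this, Real.log_div (by positivity) hpow.ne', Real.log_mul (by positivity) (by norm_num),
          Real.log_rpow hS']
        ring
  -- `K ^ π ≤ 1 + π (K - 1)` by Bernoulli's inequality, and the posteriors sum to at most `1`
  have hsub : ∀ z, ∑ m ∈ S, K ^ (v m z / s z) ≤ 2 * K := by
    intro z
    have h1 : ∀ m ∈ S, K ^ (v m z / s z) ≤ 1 + v m z / s z * (K - 1) := by
      intro m hm
      have hle : v m z ≤ s z := Finset.single_le_sum (f := fun m => v m z)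
        (fun m _ => hv0 m z) hm
      have := rpow_one_add_le_one_add_mul_self (s := K - 1) (by linarith)
        (div_nonneg (hv0 m z) (hs0 z)) (div_le_one_of_le₀ hle (hs0 z))
      simpa using this
    refine (Finset.sum_le_sum h1).trans ?_
    rw [Finset.sum_add_distrib, ← Finset.sum_mul, ← Finset.sum_div, Finset.sum_const,
      nsmul_eq_mul, mul_one]
    have : s z / s z * (K - 1) ≤ 1 * (K - 1) :=
      mul_le_mul_of_nonneg_right (div_self_le_one _) (by linarith)
    change K + s z / s z * (K - 1) ≤ 2 * K
    linarith
  have hsum := Finset.sum_le_sum fun m hm => Finset.sum_le_sum fun z (_ : z ∈ Finset.univ) =>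
    hterm m hm z
  simp only [Finset.sum_sub_distrib, Finset.sum_add_distrib, ← Finset.mul_sum,
    ← Finset.sum_mul] at hsum
  have hvsum : ∑ m ∈ S, ∑ z, v m z = K := by
    simp [hv, sum_blockChannel hT, hK]
  have hr : ∑ m ∈ S, ∑ z, q z * K ^ (v m z / s z) / 2 ≤ K := by
    rw [Finset.sum_comm]
    calc ∑ z, ∑ m ∈ S, q z * K ^ (v m z / s z) / 2 ≤ ∑ z, q z * K := by
          refine Finset.sum_le_sum fun z _ => ?_
          rw [← Finset.sum_div, ← Finset.mul_sum]
          have := mul_le_mul_of_nonneg_left (hsub z) (hq0 z)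
          linarith
      _ = K := by rw [← Finset.sum_mul, hq1, one_mul]
  rw [hvsum] at hsum
  linarith

end fano

/-! ### The decoding error -/

section error

variable {X Y Z : Type*} {q : X → Y → EReal} {n M : ℕ}

lemma sum_decodeProb (c : Fin M → Fin n → X) (y : Fin n → Y) (hM : 0 < M) :
    ∑ m, decodeProb q c y m = 1 := by
  classical
  have hne : (maximizers q c y).Nonempty := by
    obtain ⟨m, -, hm⟩ := Finset.exists_max_image (Finset.univ : Finset (Fin M))
      (fun m => blockMetric q (c m) y) ⟨⟨0, hM⟩, Finset.mem_univ _⟩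
    exact ⟨m, by simpa [maximizers] using fun j => hm j (Finset.mem_univ j)⟩
  have : ((maximizers q c y).card : ℝ) ≠ 0 := by exact_mod_cast hne.card_pos.ne'
  simp only [decodeProb, Finset.sum_ite_mem, Finset.univ_inter, Finset.sum_const, nsmul_eq_mul]
  field_simp

lemma decodeProb_nonneg (c : Fin M → Fin n → X) (y : Fin n → Y) (m : Fin M) :
    0 ≤ decodeProb q c y m := by
  unfold decodeProb
  split_ifs <;> positivity

/-- The probability of not decoding `m` when the output is `y`. -/
noncomputable def missProb (q : X → Y → EReal) (c : Fin M → Fin n → X) (m : Fin M)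
    (y : Fin n → Y) : ℝ :=
  ∑ m' ∈ Finset.univ.erase m, decodeProb q c y m'

lemma missProb_nonneg (c : Fin M → Fin n → X) (m : Fin M) (y : Fin n → Y) :
    0 ≤ missProb q c m y :=
  Finset.sum_nonneg fun m' _ => decodeProb_nonneg c y m'

lemma half_le_missProb {c : Fin M → Fin n → X} {m m' : Fin M} (hne : m ≠ m') {y : Fin n → Y}
    (h : blockMetric q (c m) y ≤ blockMetric q (c m') y) : 1 / 2 ≤ missProb q c m y := by
  classical
  have hsum := sum_decodeProb (q := q) c y m.pos
  rw [← Finset.add_sum_erase _ _ (Finset.mem_univ m)] at hsum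
  change decodeProb q c y m + missProb q c m y = 1 at hsum
  have hle : decodeProb q c y m ≤ 1 / 2 := by
    unfold decodeProb
    split_ifs with hm
    · have hm2 : ∀ j, blockMetric q (c j) y ≤ blockMetric q (c m) y := by
        simpa [maximizers] using hm
      have hm' : m' ∈ maximizers q c y := by
        simpa [maximizers] using fun j => (hm2 j).trans h
      have h2 : 2 ≤ (maximizers q c y).card := by
        rw [← Finset.card_pair hne]
        exact Finset.card_le_card (by
          intro j hj
          rcases Finset.mem_insert.1 hj with rfl | hj
          · exact hm
          · rwa [Finset.mem_singleton.1 hj])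
      exact one_div_le_one_div_of_le (by norm_num) (by exact_mod_cast h2)
    · norm_num
  linarith

lemma sum_missProb [Fintype Y] (W : X → Y → ℝ) (c : Fin M → Fin n → X) (hM : 0 < M) :
    ∑ m, ∑ y, blockChannel W (c m) y * missProb q c m y = M * errorProb W q c := by
  have : (M : ℝ) ≠ 0 := by exact_mod_cast hM.ne'
  unfold errorProb missProb
  field_simp

lemma exists_pos_le_abs {ι : Type*} [Finite ι] (f : ι → ℝ) :
    ∃ δ : ℝ, 0 < δ ∧ ∀ i, f i ≠ 0 → δ ≤ |f i| := by
  classical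
  have := Fintype.ofFinite ι
  by_cases h : (Finset.univ.filter fun i => f i ≠ 0).Nonempty
  · obtain ⟨j, hj, hmin⟩ := Finset.exists_min_image _ (fun i => |f i|) h
    exact ⟨|f j|, abs_pos.2 (by simpa using hj), fun i hi => hmin i (by simpa using hi)⟩
  · exact ⟨1, one_pos, fun i hi => (h ⟨i, by simpa using hi⟩).elim⟩

lemma blockMetric_eq_bot {w : Fin n → X} {y : Fin n → Y} {k : Fin n} (h : q (w k) (y k) = ⊥) :
    blockMetric q w y = ⊥ := by
  have hn : (0 : ℝ) < n := by exact_mod_cast k.pos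
  rw [blockMetric, sum_eq_bot (Finset.mem_univ k) h, EReal.coe_mul_bot_of_pos (by positivity)]

lemma blockMetric_eq_coe {w : Fin n → X} {y : Fin n → Y} (htop : ∀ x y, q x y ≠ ⊤)
    (h : ∀ k, q (w k) (y k) ≠ ⊥) :
    blockMetric q w y = ((1 / (n : ℝ) * ∑ k, (q (w k) (y k)).toReal : ℝ) : EReal) := by
  rw [blockMetric, EReal.coe_mul, coe_sum_ereal]
  congr 1
  exact Finset.sum_congr rfl fun k _ => (EReal.coe_toReal (htop _ _) (h k)).symm

lemma blockMetric_le_of_sum_nonneg {w w' : Fin n → X} {y : Fin n → Y} (htop : ∀ x y, q x y ≠ ⊤)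
    (h : ∀ k, q (w k) (y k) ≠ ⊥) (h' : ∀ k, q (w' k) (y k) ≠ ⊥)
    (hs : 0 ≤ ∑ k, ((q (w' k) (y k)).toReal - (q (w k) (y k)).toReal)) :
    blockMetric q w y ≤ blockMetric q w' y := by
  rw [blockMetric_eq_coe htop h, blockMetric_eq_coe htop h', EReal.coe_le_coe_iff]
  rw [Finset.sum_sub_distrib] at hs
  exact mul_le_mul_of_nonneg_left (by linarith) (by positivity)

variable [Fintype Y]

/-- A word containing an input `w k` that can produce an output `b` of metric `⊥` is decoded
wrongly with a probability bounded below: whenever `b` occurs at position `k`, every other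
codeword is at least as good. -/
lemma le_sum_missProb_of_bot {W : X → Y → ℝ} (hW : IsChannel W) {c : Fin M → Fin n → X}
    (hM : 2 ≤ M) (m : Fin M) (k : Fin n) {b : Y} (hb : q (c m k) b = ⊥) :
    W (c m k) b / 2 ≤ ∑ y, blockChannel W (c m) y * missProb q c m y := by
  classical
  obtain ⟨m', hm'⟩ : ∃ m', m ≠ m' := by
    have : Nontrivial (Fin M) := Fin.nontrivial_iff_two_le.2 hM
    obtain ⟨m', h⟩ := exists_ne m
    exact ⟨m', h.symm⟩
  have h1 := prodExpect_prod (fun j => W (c m j))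
    (fun j a => if j = k then if a = b then (1 : ℝ) else 0 else 1)
  have h2 : ∏ j, ∑ a, W (c m j) a * (if j = k then if a = b then (1 : ℝ) else 0 else 1)
      = W (c m k) b := by
    rw [Finset.prod_eq_single k]
    · simp
    · intro j _ hj
      simp [hj, (hW (c m j)).2]
    · simp
  rw [h2] at h1
  rw [← h1, prodExpect, Finset.sum_div]
  refine Finset.sum_le_sum fun y _ => ?_
  rw [mul_div_assoc]
  refine mul_le_mul_of_nonneg_left ?_ (blockChannel_nonneg hW _ _)
  rw [Finset.prod_ite_eq' Finset.univ k]
  simp only [Finset.mem_univ, if_true]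
  split_ifs with hy
  · refine half_le_missProb hm' ?_
    rw [blockMetric_eq_bot (by rw [hy]; exact hb)]
    exact bot_le
  · simpa using missProb_nonneg c m y

/-- The expectation of `f(Y)` on the event that the second output is `z`, when the word `w` is sent
over the memoryless extension of `V`. -/
noncomputable def jointMass (V : X → Y × Z → ℝ) (w : Fin n → X) (z : Fin n → Z)
    (f : (Fin n → Y) → ℝ) : ℝ :=
  prodExpect (fun k b => V (w k) (b, z k)) f

lemma jointMass_nonneg [Fintype Z] {V : X → Y × Z → ℝ} (hV : IsChannel V) (w : Fin n → X)
    (z : Fin n → Z) {f : (Fin n → Y) → ℝ} (hf : ∀ y, 0 ≤ f y) : 0 ≤ jointMass V w z f :=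
  Finset.sum_nonneg fun y _ => mul_nonneg (Finset.prod_nonneg fun _ _ => (hV _).1 _) (hf y)

lemma sum_jointMass [Fintype Z] {V : X → Y × Z → ℝ} {W : X → Y → ℝ}
    (hVW : ∀ x y, ∑ z, V x (y, z) = W x y) (w : Fin n → X) (f : (Fin n → Y) → ℝ) :
    ∑ z, jointMass V w z f = ∑ y, blockChannel W w y * f y := by
  classical
  unfold jointMass prodExpect
  rw [Finset.sum_comm]
  refine Finset.sum_congr rfl fun y _ => ?_
  rw [← Finset.sum_mul, blockChannel]
  congr 1
  simp only [← hVW]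
  rw [Finset.prod_univ_sum, Fintype.piFinset_univ]

/-- The pairwise condition on `V` turns into a bound on the decoding errors of two words: for
every `z`, at least one of the words `w`, `w'` is confused with the other with a probability,
given `z`, that is bounded below. Take `Y` and `Y'` independent given `z`, produced by `w` and
by `w'`. The variables `q(w' k, Y k) - q(w k, Y k) - q(w' k, Y' k) + q(w k, Y' k)` are independent
with nonnegative means, so that their sum is nonnegative with a probability bounded below; and then
`w'` beats `w` on `Y`, or `w` beats `w'` on `Y'`. -/
theorem exists_confusion_bound [Fintype X] [Fintype Z] (htop : ∀ x y, q x y ≠ ⊤) :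
    ∃ c : ℝ, 0 < c ∧ ∀ (P : X → ℝ) (V : X → Y × Z → ℝ), P ∈ stdSimplex ℝ X → V ∈ channelSet q P →
      expect (fun a : X × Y × Z => P a.1 * V a.1 a.2) (fun a => q a.1 a.2.1) ≠ ⊥ →
      ∀ (n : ℕ) (w w' : Fin n → X) (z : Fin n → Z) (f f' : (Fin n → Y) → ℝ),
        (∀ k, 0 < P (w k)) → (∀ k, 0 < P (w' k)) → (∀ y, 0 ≤ f y) → (∀ y, 0 ≤ f' y) →
        (∀ y, blockMetric q w y ≤ blockMetric q w' y → 1 / 2 ≤ f y) →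
        (∀ y, blockMetric q w' y ≤ blockMetric q w y → 1 / 2 ≤ f' y) →
        c * (blockChannel (channelZ V) w z * blockChannel (channelZ V) w' z) ≤
          jointMass V w z f * blockChannel (channelZ V) w' z +
          jointMass V w' z f' * blockChannel (channelZ V) w z := by
  classical
  set L : X → X → Y → ℝ := fun x x' y => (q x' y).toReal - (q x y).toReal with hL
  set D : (X × X) × (Y × Y) → ℝ := fun a => L a.1.1 a.1.2 a.2.1 - L a.1.1 a.1.2 a.2.2 with hD
  obtain ⟨δ, hδ, hgap⟩ := exists_pos_le_abs D
  obtain ⟨b, hb, hbd⟩ : ∃ b : ℝ, 0 < b ∧ ∀ a, |D a| ≤ b := by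
    refine ⟨∑ a, |D a| + 1, ?_, fun a => ?_⟩
    · have : 0 ≤ ∑ a, |D a| := Finset.sum_nonneg fun a _ => abs_nonneg _
      linarith
    · have := Finset.single_le_sum (f := fun a => |D a|) (fun a _ => abs_nonneg _)
        (Finset.mem_univ a)
      linarith
  obtain ⟨c, hc, hanti⟩ := exists_le_prodExpect_sum_nonneg (Y × Y) hδ hb
  refine ⟨c / 2, by positivity, ?_⟩
  intro P V hP hVq hbot n w w' z f f' hw hw' hf hf' hff hff'
  have hV : IsChannel V := hVq.1
  have hZ0 : ∀ x z, 0 ≤ channelZ V x z := fun x z => Finset.sum_nonneg fun y _ => (hV x).1 _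
  set v := blockChannel (channelZ V) w z with hv
  set v' := blockChannel (channelZ V) w' z with hv'
  have hv0 : 0 ≤ v := Finset.prod_nonneg fun k _ => hZ0 _ _
  have hv0' : 0 ≤ v' := Finset.prod_nonneg fun k _ => hZ0 _ _
  have hJ := jointMass_nonneg hV w z hf
  have hJ' := jointMass_nonneg hV w' z hf'
  rcases hv0.eq_or_lt with h0 | hvp
  · rw [← h0, zero_mul, mul_zero, mul_zero, add_zero]; exact mul_nonneg hJ hv0'
  rcases hv0'.eq_or_lt with h0 | hvp'
  · rw [← h0, mul_zero, mul_zero, mul_zero, zero_add]; exact mul_nonneg hJ' hv0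
  have hz : ∀ k, 0 < channelZ V (w k) (z k) := fun k => lt_of_le_of_ne (hZ0 _ _)
    (Finset.prod_ne_zero_iff.1 hvp.ne' k (Finset.mem_univ k)).symm
  have hz' : ∀ k, 0 < channelZ V (w' k) (z k) := fun k => lt_of_le_of_ne (hZ0 _ _)
    (Finset.prod_ne_zero_iff.1 hvp'.ne' k (Finset.mem_univ k)).symm
  have hself : ∀ x, 0 < P x → ∀ y z, V x (y, z) ≠ 0 → q x y ≠ ⊥ := fun x hx y z h =>
    ne_bot_of_expect_ne_bot hP.1 hV hbot hx.ne' h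
  have hpair : ∀ k, (∀ y, V (w k) (y, z k) ≠ 0 → q (w' k) y ≠ ⊥) ∧
      (∀ y, V (w' k) (y, z k) ≠ 0 → q (w k) y ≠ ⊥) ∧
      0 ≤ channelZ V (w' k) (z k) * ∑ y, V (w k) (y, z k) * L (w k) (w' k) y
        - channelZ V (w k) (z k) * ∑ y, V (w' k) (y, z k) * L (w k) (w' k) y := by
    intro k
    by_cases hne : w k = w' k
    · rw [← hne]
      exact ⟨fun y => hself _ (hw k) y _, fun y => hself _ (hw k) y _, by simp⟩
    · have h1 := channelSet_pairwise htop hP hVq hbot hne (hw k) (hw' k) (hz k) (hz' k)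
      have h2 := channelSet_pairwise htop hP hVq hbot (Ne.symm hne) (hw' k) (hw k) (hz' k) (hz k)
      refine ⟨h1.1, h2.1, h1.2.trans_eq ?_⟩
      have : ∑ y, V (w' k) (y, z k) * ((q (w k) y).toReal - (q (w' k) y).toReal)
          = - ∑ y, V (w' k) (y, z k) * L (w k) (w' k) y := by
        rw [← Finset.sum_neg_distrib]
        exact Finset.sum_congr rfl fun y _ => by simp only [hL]; ring
      rw [this]; ring
  set g : Fin n → Y → ℝ := fun k y => V (w k) (y, z k) / channelZ V (w k) (z k) with hg
  set g' : Fin n → Y → ℝ := fun k y => V (w' k) (y, z k) / channelZ V (w' k) (z k) with hg'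
  have hg0 : ∀ k y, 0 ≤ g k y := fun k y => div_nonneg ((hV _).1 _) (hZ0 _ _)
  have hg0' : ∀ k y, 0 ≤ g' k y := fun k y => div_nonneg ((hV _).1 _) (hZ0 _ _)
  have hg1 : ∀ k, ∑ y, g k y = 1 := fun k => by
    rw [← Finset.sum_div]; exact div_self (hz k).ne'
  have hg1' : ∀ k, ∑ y, g' k y = 1 := fun k => by
    rw [← Finset.sum_div]; exact div_self (hz' k).ne'
  have hprod : ∀ k, (fun a : Y × Y => g k a.1 * g' k a.2) ∈ stdSimplex ℝ (Y × Y) := by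
    refine fun k => ⟨fun a => mul_nonneg (hg0 k _) (hg0' k _), ?_⟩
    rw [Fintype.sum_prod_type]
    simp only [← Finset.mul_sum, hg1', hg1, mul_one]
  have hlow := hanti n (fun k a => g k a.1 * g' k a.2) (fun k a => D ((w k, w' k), a)) hprod
    (fun k a => hbd _) (fun k a => hgap _) (by
      intro k
      have e : ∑ a : Y × Y, g k a.1 * g' k a.2 * D ((w k, w' k), a)
          = ∑ y, g k y * L (w k) (w' k) y - ∑ y, g' k y * L (w k) (w' k) y := by
        have e1 : ∀ y y', g k y * g' k y' * D ((w k, w' k), (y, y'))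
            = (g k y * L (w k) (w' k) y) * g' k y' - g k y * (g' k y' * L (w k) (w' k) y') := by
          intro y y'; simp only [hD]; ring
        simp only [Fintype.sum_prod_type, e1, Finset.sum_sub_distrib, ← Finset.mul_sum, hg1',
          ← Finset.sum_mul, hg1, mul_one, one_mul]
      rw [e]
      simp only [hg, hg', div_mul_eq_mul_div, ← Finset.sum_div]
      rw [div_sub_div _ _ (hz k).ne' (hz' k).ne']
      refine div_nonneg ?_ (mul_pos (hz k) (hz' k)).le
      rw [mul_comm (∑ y, _) (channelZ V (w' k) (z k))]
      exact (hpair k).2.2)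
  set F : (Fin n → Y) → ℝ := fun y => if 0 ≤ ∑ k, L (w k) (w' k) (y k) then 1 else 0 with hF
  set F' : (Fin n → Y) → ℝ := fun y => if ∑ k, L (w k) (w' k) (y k) ≤ 0 then 1 else 0 with hF'
  have hup : prodExpect (fun k (a : Y × Y) => g k a.1 * g' k a.2)
      (fun y => if 0 ≤ ∑ k, D ((w k, w' k), y k) then 1 else 0) ≤
      prodExpect g F + prodExpect g' F' := by
    have e1 := prodExpect_prod_mul g g' F (fun _ => 1)
    have e2 := prodExpect_prod_mul g g' (fun _ => 1) F'
    rw [prodExpect_one hg1', mul_one] at e1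
    rw [prodExpect_one hg1, one_mul] at e2
    rw [← e1, ← e2, ← prodExpect_add]
    refine prodExpect_mono (fun k a => mul_nonneg (hg0 k _) (hg0' k _)) fun y => ?_
    simp only [hF, hF', hD, Finset.sum_sub_distrib, mul_one, one_mul]
    split_ifs <;> linarith
  have hJF : v * prodExpect g F ≤ 2 * jointMass V w z f := by
    rw [jointMass, prodExpect, prodExpect, Finset.mul_sum, Finset.mul_sum]
    refine Finset.sum_le_sum fun y _ => ?_
    have e : v * ((∏ k, g k (y k)) * F y) = (∏ k, V (w k) (y k, z k)) * F y := by
      rw [← mul_assoc]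
      congr 1
      simp only [hg, hv, blockChannel, ← Finset.prod_mul_distrib]
      exact Finset.prod_congr rfl fun k _ => mul_div_cancel₀ _ (hz k).ne'
    rw [e, mul_left_comm]
    by_cases h0 : ∏ k, V (w k) (y k, z k) = 0
    · simp [h0]
    have hne := fun k => Finset.prod_ne_zero_iff.1 h0 k (Finset.mem_univ k)
    refine mul_le_mul_of_nonneg_left ?_ (Finset.prod_nonneg fun k _ => (hV _).1 _)
    simp only [hF]
    split_ifs with hs
    · have := hff y (blockMetric_le_of_sum_nonneg htop (fun k => hself _ (hw k) _ _ (hne k))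
        (fun k => (hpair k).1 _ (hne k)) hs)
      linarith
    · have := hf y; positivity
  have hJF' : v' * prodExpect g' F' ≤ 2 * jointMass V w' z f' := by
    rw [jointMass, prodExpect, prodExpect, Finset.mul_sum, Finset.mul_sum]
    refine Finset.sum_le_sum fun y _ => ?_
    have e : v' * ((∏ k, g' k (y k)) * F' y) = (∏ k, V (w' k) (y k, z k)) * F' y := by
      rw [← mul_assoc]
      congr 1
      simp only [hg', hv', blockChannel, ← Finset.prod_mul_distrib]
      exact Finset.prod_congr rfl fun k _ => mul_div_cancel₀ _ (hz' k).ne'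
    rw [e, mul_left_comm]
    by_cases h0 : ∏ k, V (w' k) (y k, z k) = 0
    · simp [h0]
    have hne := fun k => Finset.prod_ne_zero_iff.1 h0 k (Finset.mem_univ k)
    refine mul_le_mul_of_nonneg_left ?_ (Finset.prod_nonneg fun k _ => (hV _).1 _)
    simp only [hF']
    split_ifs with hs
    · have hs' : 0 ≤ ∑ k, ((q (w k) (y k)).toReal - (q (w' k) (y k)).toReal) := by
        simp only [hL, Finset.sum_sub_distrib] at hs ⊢
        linarith
      have := hff' y (blockMetric_le_of_sum_nonneg htop (fun k => hself _ (hw' k) _ _ (hne k))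
        (fun k => (hpair k).2.1 _ (hne k)) hs')
      linarith
    · have := hf' y; positivity
  have h1 : c ≤ prodExpect g F + prodExpect g' F' := hlow.trans hup
  nlinarith [mul_le_mul_of_nonneg_left h1 (mul_pos hvp hvp').le,
    mul_le_mul_of_nonneg_left hJF hv0', mul_le_mul_of_nonneg_left hJF' hv0]

/-- Nonnegative weights `v` with total `s` and error masses `e` on a finite set. If every two
distinct elements have enough error between them, then so does the set, up to the collision mass
`∑ v ^ 2 / s`. -/
lemma sum_ge_of_pairwise {ι : Type*} {S : Finset ι} {v e : ι → ℝ} {c : ℝ}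
    (hv : ∀ m, 0 ≤ v m) (he : ∀ m, 0 ≤ e m)
    (h : ∀ m ∈ S, ∀ m' ∈ S, m ≠ m' → c * (v m * v m') ≤ e m * v m' + e m' * v m) :
    c / 2 * (∑ m ∈ S, v m - ∑ m ∈ S, v m * (v m / ∑ m' ∈ S, v m')) ≤ ∑ m ∈ S, e m := by
  classical
  set s := ∑ m ∈ S, v m with hs
  have hs0 : 0 ≤ s := Finset.sum_nonneg fun m _ => hv m
  have hall : ∀ m ∈ S, ∀ m' ∈ S,
      c * (v m * v m') - (if m = m' then c * (v m * v m) else 0) ≤ e m * v m' + e m' * v m := by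
    intro m hm m' hm'
    split_ifs with hmm
    · subst hmm
      have := mul_nonneg (he m) (hv m)
      linarith
    · have := h m hm m' hm' hmm
      linarith
  have hsum := Finset.sum_le_sum fun m hm => Finset.sum_le_sum fun m' hm' => hall m hm m' hm'
  have e1 : ∑ m ∈ S, ∑ m' ∈ S, (c * (v m * v m') - (if m = m' then c * (v m * v m) else 0))
      = c * (s * s - ∑ m ∈ S, v m * v m) := by
    have e : ∀ m ∈ S, (if m ∈ S then c * (v m * v m) else 0) = c * (v m * v m) :=
      fun m hm => if_pos hm
    simp only [Finset.sum_sub_distrib, ← Finset.mul_sum, ← Finset.sum_mul, ← hs,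
      Finset.sum_ite_eq]
    rw [Finset.sum_congr rfl e, ← Finset.mul_sum, mul_sub]
  have e2 : ∑ m ∈ S, ∑ m' ∈ S, (e m * v m' + e m' * v m) = 2 * ((∑ m ∈ S, e m) * s) := by
    simp only [Finset.sum_add_distrib, ← Finset.mul_sum, ← Finset.sum_mul, ← hs]
    ring
  rw [e1, e2] at hsum
  rcases hs0.eq_or_lt with h0 | hsp
  · rw [← h0]
    simpa using Finset.sum_nonneg fun m _ => he m
  · have e3 : ∑ m ∈ S, v m * (v m / s) = (∑ m ∈ S, v m * v m) / s := by
      rw [Finset.sum_div]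
      exact Finset.sum_congr rfl fun m _ => by ring
    rw [e3]
    have e4 : c / 2 * (s - (∑ m ∈ S, v m * v m) / s)
        = c * (s * s - ∑ m ∈ S, v m * v m) / (2 * s) := by field_simp
    rw [e4, div_le_iff₀ (by positivity)]
    linarith

end error

/-! ### The converse -/

lemma isChannel_channelZ {X Y Z : Type*} [Fintype Y] [Fintype Z] {V : X → Y × Z → ℝ}
    (hV : IsChannel V) : IsChannel (channelZ V) := by
  refine fun x => ⟨fun z => Finset.sum_nonneg fun y _ => (hV x).1 _, ?_⟩
  unfold channelZ
  rw [Finset.sum_comm, ← Fintype.sum_prod_type', (hV x).2]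

lemma mutualInfo_channelZ_nonneg {X Y Z : Type*} [Fintype X] [Fintype Y] [Fintype Z]
    {P : X → ℝ} (hP : P ∈ stdSimplex ℝ X) {V : X → Y × Z → ℝ} (hV : IsChannel V) :
    0 ≤ mutualInfo fun x z => P x * channelZ V x z := by
  have hT := isChannel_channelZ hV
  refine mutualInfo_nonneg (fun x z => mul_nonneg (hP.1 x) ((hT x).1 z)) ?_
  simp only [← Finset.mul_sum, (hT _).2, mul_one, hP.2]

/-- The codewords without an input that can produce an output of metric `⊥`. -/
def IsClean {X Y : Type*} (W : X → Y → ℝ) (q : X → Y → EReal) {n : ℕ} (w : Fin n → X) : Prop :=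
  ∀ k y, W (w k) y ≠ 0 → q (w k) y ≠ ⊥

/-- If the codewords in `S` are pairwise confusable given the second output `z`, then their total
error mass dominates the mass on which a draw from the posterior law on `S` given `z` misses the
message. -/
lemma card_sub_le_error {X Y Z : Type*} [Fintype Y] [Fintype Z]
    {W : X → Y → ℝ} {q : X → Y → EReal} {V : X → Y × Z → ℝ} (hV : IsChannel V)
    (hVW : ∀ x y, ∑ z, V x (y, z) = W x y) {n M : ℕ} (x : Fin M → Fin n → X) (S : Finset (Fin M))
    {c : ℝ}
    (hconf : ∀ m ∈ S, ∀ m' ∈ S, m ≠ m' → ∀ z : Fin n → Z,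
      c * (blockChannel (channelZ V) (x m) z * blockChannel (channelZ V) (x m') z) ≤
        jointMass V (x m) z (missProb q x m) * blockChannel (channelZ V) (x m') z +
        jointMass V (x m') z (missProb q x m') * blockChannel (channelZ V) (x m) z) :
    c / 2 * (S.card - ∑ m ∈ S, ∑ z, blockChannel (channelZ V) (x m) z *
        (blockChannel (channelZ V) (x m) z / ∑ m' ∈ S, blockChannel (channelZ V) (x m') z)) ≤
      ∑ m ∈ S, ∑ y, blockChannel W (x m) y * missProb q x m y := by
  have hT := isChannel_channelZ hV
  have h := Finset.sum_le_sum fun z (_ : z ∈ (Finset.univ : Finset (Fin n → Z))) =>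
    sum_ge_of_pairwise (S := S) (v := fun m => blockChannel (channelZ V) (x m) z)
      (e := fun m => jointMass V (x m) z (missProb q x m))
      (fun m => blockChannel_nonneg hT _ _)
      (fun m => jointMass_nonneg hV _ _ fun y => missProb_nonneg x m y)
      (fun m hm m' hm' hne => hconf m hm m' hm' hne z)
  rw [← Finset.mul_sum, Finset.sum_sub_distrib] at h
  rw [Finset.sum_comm (t := S), Finset.sum_comm (t := S), Finset.sum_comm (t := S)] at h
  simp only [sum_blockChannel hT, sum_jointMass hVW, Finset.sum_const, nsmul_eq_mul, mul_one] at h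
  exact h

end MismatchDecoding

open MismatchDecoding in
theorem theorem1 {X Y Z : Type*} [Fintype X] [Fintype Y] [Fintype Z]
    (W : X → Y → ℝ) (hW : MismatchDecoding.IsChannel W)
    (q : X → Y → EReal) (hq : ∀ x y, q x y ≠ ⊤) :
    MismatchDecoding.mismatchCapacity W q ≤ MismatchDecoding.capacityBound Z W q := by
  classical
  refine iSup₂_le fun R hR => ?_
  by_contra hlt
  obtain ⟨r, hr1, hr2⟩ := EReal.lt_iff_exists_real_btwn.1 (not_le.1 hlt)
  have hrR : r < R := EReal.coe_lt_coe_iff.1 hr2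
  have hex : ∀ P ∈ stdSimplex ℝ X, ∃ V ∈ channelSet (Z := Z) q P,
      (∀ x y, ∑ z, V x (y, z) = W x y) ∧ mutualInfo (fun x z => P x * channelZ V x z) < r := by
    intro P hP
    have h := (le_iSup₂ (f := fun (P : X → ℝ) (_ : P ∈ stdSimplex ℝ X) =>
      ⨅ (V : X → Y × Z → ℝ) (_ : V ∈ channelSet q P) (_ : ∀ x y, ∑ z, V x (y, z) = W x y),
      ((mutualInfo fun x z => P x * ∑ y, V x (y, z) : ℝ) : EReal)) P hP).trans_lt hr1
    simp only [iInf_lt_iff] at h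
    obtain ⟨V, hV, hVW, hI⟩ := h
    exact ⟨V, hV, hVW, EReal.coe_lt_coe_iff.1 hI⟩
  obtain ⟨M, x, hM, hlim⟩ := hR
  -- a code of block length one exists, so that the input alphabet is nonempty
  have hr0 : 0 < r := by
    have hP : wordLaw Finset.univ (x 1) ∈ stdSimplex ℝ X :=
      wordLaw_mem_stdSimplex ⟨⟨0, (hM 1 le_rfl).1⟩, Finset.mem_univ _⟩ one_pos
    obtain ⟨V, hV, -, hI⟩ := hex _ hP
    exact (mutualInfo_channelZ_nonneg hP hV.1).trans_lt hI
  obtain ⟨c, hc, hconf⟩ := exists_confusion_bound (Z := Z) hq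
  obtain ⟨δ, hδ, hgap⟩ := exists_pos_le_abs fun a : X × Y => W a.1 a.2
  set ε : ℕ → ℝ := fun n => errorProb W q (x n) with hε
  have hlog : Filter.Tendsto (fun n : ℕ => Real.log 2 / n) Filter.atTop (nhds 0) :=
    tendsto_const_div_atTop_nhds_zero_nat _
  -- the lower bound on `I(X; Z)` that Fano's inequality will give at block length `n`
  have hf : Filter.Tendsto (fun n : ℕ => (R - Real.log 2 / n) * (1 - 4 / c * ε n)
      - Real.log 2 / n) Filter.atTop (nhds R) := by
    have := ((tendsto_const_nhds (x := R)).sub hlog).mul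
      ((tendsto_const_nhds (x := (1 : ℝ))).sub (hlim.const_mul (4 / c)))
    simpa using this.sub hlog
  obtain ⟨n, hn, hfn, hε1, hε2⟩ := ((Filter.eventually_ge_atTop 1).and
    ((hf.eventually (lt_mem_nhds hrR)).and ((hlim.eventually
      (gt_mem_nhds (by positivity : 0 < δ / 4))).and (hlim.eventually
      (gt_mem_nhds (by positivity : 0 < c / 4)))))).exists
  change ε n < δ / 4 at hε1
  change ε n < c / 4 at hε2
  have hn0 : (0 : ℝ) < n := by exact_mod_cast hn
  obtain ⟨hM1, hrate⟩ := hM n hn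
  have hM0 : (0 : ℝ) < M n := by exact_mod_cast hM1
  have hrate' : n * R ≤ Real.log (M n) := by
    rw [one_div_mul_eq_div, le_div_iff₀ hn0] at hrate
    linarith
  have hM2 : 2 ≤ M n := by
    have h1 : 0 < Real.log (M n) := lt_of_lt_of_le (mul_pos hn0 (hr0.trans hrR)) hrate'
    have h2 : (1 : ℝ) < M n := (Real.log_pos_iff hM0.le).1 h1
    exact_mod_cast h2
  set e : Fin (M n) → ℝ := fun m => ∑ y, blockChannel W (x n m) y * missProb q (x n) m y with he
  have he0 : ∀ m, 0 ≤ e m := fun m => Finset.sum_nonneg fun y _ =>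
    mul_nonneg (blockChannel_nonneg hW _ _) (missProb_nonneg _ _ _)
  have hesum : ∑ m, e m = M n * ε n := sum_missProb W (x n) hM1
  set S := Finset.univ.filter fun m => IsClean W q (x n m) with hS
  set K : ℝ := (S.card : ℝ) with hK
  -- the codewords outside `S` have error at least `δ / 2` each, and the total is at most `M δ / 4`
  have hKM : (M n : ℝ) ≤ 2 * K := by
    have h1 : ∀ m, δ / 2 * (1 - if IsClean W q (x n m) then 1 else 0) ≤ e m := by
      intro m
      split_ifs with h
      · simpa using he0 m
      · unfold IsClean at h
        push Not at h
        obtain ⟨k, y, hy, hb⟩ := h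
        have h2 := le_sum_missProb_of_bot hW hM2 m k hb
        have h3 := hgap (x n m k, y) hy
        rw [abs_of_nonneg ((hW _).1 _)] at h3
        change δ ≤ W (x n m k) y at h3
        change _ ≤ e m at h2
        linarith
    have h2 := Finset.sum_le_sum fun m (_ : m ∈ Finset.univ) => h1 m
    rw [hesum, ← Finset.mul_sum, Finset.sum_sub_distrib, Finset.sum_boole, ← hS, ← hK] at h2
    simp only [Finset.sum_const, Finset.card_univ, Fintype.card_fin, nsmul_eq_mul, mul_one] at h2
    have h3 : (M n : ℝ) * ε n ≤ M n * (δ / 4) := mul_le_mul_of_nonneg_left hε1.le hM0.le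
    have h4 : δ * (M n - 2 * K) ≤ 0 := by linarith
    by_contra hcon
    have := mul_pos hδ (sub_pos.2 (not_le.1 hcon))
    linarith
  have hK0 : 0 < K := by linarith
  have hSne : S.Nonempty := Finset.card_pos.1 (Nat.cast_pos.1 hK0)
  set P := wordLaw S (x n) with hPdef
  have hP : P ∈ stdSimplex ℝ X := wordLaw_mem_stdSimplex hSne hn
  obtain ⟨V, hV, hVW, hI⟩ := hex P hP
  have hPpos : ∀ m ∈ S, ∀ k, 0 < P (x n m k) := fun m hm k => wordLaw_pos hm k
  have hbot : expect (fun a : X × Y × Z => P a.1 * V a.1 a.2) (fun a => q a.1 a.2.1) ≠ ⊥ := by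
    rw [expect_eq_coe (fun a => hq _ _)]
    · exact EReal.coe_ne_bot _
    · rintro ⟨a, y, z⟩ h
      obtain ⟨m, hm, k, rfl⟩ := exists_of_wordLaw_ne_zero (left_ne_zero_of_mul h)
      refine (Finset.mem_filter.1 hm).2 k y ?_
      rw [← hVW]
      exact (Finset.sum_pos' (f := fun z => V (x n m k) (y, z)) (fun z _ => (hV.1 _).1 _)
        ⟨z, Finset.mem_univ z, lt_of_le_of_ne ((hV.1 _).1 _) (right_ne_zero_of_mul h).symm⟩).ne'
  set G := ∑ m ∈ S, ∑ z, blockChannel (channelZ V) (x n m) z *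
        (blockChannel (channelZ V) (x n m) z / ∑ m' ∈ S, blockChannel (channelZ V) (x n m') z)
    with hG
  have hlow : c / 2 * (K - G) ≤ ∑ m ∈ S, e m := by
    refine card_sub_le_error hV.1 hVW (x n) S fun m hm m' hm' hne z => ?_
    exact hconf P V hP hV hbot n (x n m) (x n m') z _ _ (hPpos m hm) (hPpos m' hm')
      (missProb_nonneg _ _) (missProb_nonneg _ _) (fun y h => half_le_missProb hne h)
      (fun y h => half_le_missProb hne.symm h)
  have hup : ∑ m ∈ S, e m ≤ M n * ε n := by
    rw [← hesum]
    exact Finset.sum_le_univ_sum_of_nonneg he0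
  have hε0 : 0 ≤ ε n := by
    have : 0 ≤ (M n : ℝ) * ε n := by rw [← hesum]; exact Finset.sum_nonneg fun m _ => he0 m
    exact nonneg_of_mul_nonneg_right this hM0
  have hGK : K * (1 - 4 / c * ε n) ≤ G := by
    have h1 : (M n : ℝ) * ε n ≤ 2 * K * ε n := mul_le_mul_of_nonneg_right hKM hε0
    have h2 : c / 2 * (K - G) ≤ c / 2 * (K * (4 / c * ε n)) := by
      have : c / 2 * (K * (4 / c * ε n)) = 2 * K * ε n := by field_simp; ring
      linarith
    have h3 := le_of_mul_le_mul_left h2 (by positivity)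
    linarith
  have hfano : Real.log K * G - K * Real.log 2 ≤
      K * (n * mutualInfo fun a b => P a * channelZ V a b) :=
    fano_le (isChannel_channelZ hV.1) hSne hn
  have hK1 : 1 ≤ K := Nat.one_le_cast.2 hSne.card_pos
  have hlogK : n * R - Real.log 2 ≤ Real.log K := by
    have h1 := Real.log_le_log hM0 hKM
    rw [Real.log_mul (by norm_num) hK0.ne'] at h1
    linarith
  have hθ : 0 ≤ 1 - 4 / c * ε n := by
    have : 4 / c * ε n ≤ 4 / c * (c / 4) := mul_le_mul_of_nonneg_left hε2.le (by positivity)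
    have h4 : 4 / c * (c / 4) = 1 := by field_simp
    linarith
  have h1 : K * (Real.log K * (1 - 4 / c * ε n) - Real.log 2)
      ≤ K * (n * mutualInfo fun a b => P a * channelZ V a b) := by
    have := mul_le_mul_of_nonneg_left hGK (Real.log_nonneg hK1)
    linarith
  have h2 := le_of_mul_le_mul_left h1 hK0
  have h3 := mul_le_mul_of_nonneg_right hlogK hθ
  have h4 : n * (mutualInfo fun a b => P a * channelZ V a b) < n * r :=
    mul_lt_mul_of_pos_left hI hn0
  have h5 : (n : ℝ) * ((R - Real.log 2 / n) * (1 - 4 / c * ε n) - Real.log 2 / n)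
      = (n * R - Real.log 2) * (1 - 4 / c * ε n) - Real.log 2 := by
    field_simp
  have h6 := mul_lt_mul_of_pos_left hfn hn0
  linarith
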